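/- **Setting.** A tabular POMDP has finite nonempty sets of latent states $\mathcal S$, observations $\mathcal O$ and actions $\mathcal A$, an initial law on $\mathcal S$, time-homogeneous transition and emission probabilities $\mathbb T(\cdot\mid s,a)$, $\mathbb O(\cdot\mid s)$, and rewards $r_h=r_h(s_h,o_h,a_h)\in[0,1]$ at the steps $h=1,\dots,H$, where $H\ge 1$; the process may be continued (without reward) after step $H$. For $M\ge 0$ let $z_{h-1}$ be the last $\min(h-1,M)$ pairs (observation, action) before step $h$. An $M$-memory policy $\pi$ draws $a_h$ from $\pi_h(\cdot\mid z_{h-1},o_h)$; let $\Pi$ be the class of all of them, $J(\pi)=\mathbb E_\pi[\sum_{h=1}^H r_h]$, and $V^\pi_h(z,s)=\mathbb E[\sum_{h'=h}^H r_{h'}\mid z_{h-1}=z,s_h=s;a_{h:H}\sim\pi]$. For $K\ge1$ let $t_h=(o_{h:h+K-1},a_{h:h+K-2})$ be the $K$-step future, and let $\mathbb O^K$ be the matrix with entries $\mathbb O^K(t,s)=\mathbb P(t_h=t\mid s_h=s)$ under independent uniform actions. Assume that $\mathbb O^K$ has full column rank and that $\|(\mathbb O^K)^\dagger\|_1\le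 1/\sigma_1$, where $\sigma_1>0$, $\dagger$ is the Moore–Penrose inverse and $\|\cdot\|_1$ the maximal absolute column sum (this forces $\sigma_1\le1$). Let $\mathcal G$ be either the class of all $g=(g_h)_{h\le H}$ with $g_h(z,t)=\langle\theta_h,\mathbf 1(z)\otimes(\mathbb O^K)^\dagger\mathbf 1(t)\rangle$ and $\|\theta_h\|_\infty\le H$, or (a class that does not refer to the unknown model) the class of all $g$ with $\|g_h\|_\infty\le H/\sigma_1$; always $g_{H+1}=0$. A value link function of $\pi$ is a $g$ with $\mathbb E[g_h(z,t_h)\mid z_{h-1}=z,s_h=s;\text{uniform actions}]=V_h^\pi(z,s)$ for all $h\le H$, $z$, $s$. **(1) PO-bilinear structure.** The first class is contained in the second. For both, every $\pi\in\Pi$ has a value link function in $\mathcal G$, and with $d=|\mathcal S||\mathcal O|^M|\mathcal A|^M$ there are maps $W_h:\Pi\times\mathcal G\to\mathbb R^d$, $X_h:\Pi\to\mathbb R^d$ with $\|X_h\|\le1$, $\|W_h\|\le 4H\sqrt d/\sigma_1$, such that for all $h\le H$, $\pi,\pi'\in\Pi$, $g\in\mathcal G$ $$\mathbb E[g_h(z_{h-1},t_h);a_{1:h-1}\sim\pi',\,a_{h},a_{h+1},\ldots\sim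 U(\mathcal A)]-\mathbb E[r_h+g_{h+1}(z_h,t_{h+1});a_{1:h-1}\sim\pi',\,a_h\sim\pi,\,a_{h+1},\ldots\sim U(\mathcal A)]=\langle W_h(\pi,g),X_h(\pi')\rangle ,$$ and $W_h(\pi,g)=0$ whenever $g$ is a value link function of $\pi$. **(2) Algorithm.** Given $\mathcal G$ and parameters $m,T\in\mathbb N$, $R\in\mathbb R$, draw a data set $\mathcal D^0$ of $m$ independent episodes with uniform actions and choose any $\pi^0\in\Pi$. For $t=0,\dots,T-1$: for each $h=1,\dots,H$ draw a data set $\mathcal D^t_h$ of $m$ independent episodes with $a_{1:h-1}\sim\pi^t$ and uniform actions from step $h$ on, and a further data set of $m$ episodes with $a_{1:H}\sim\pi^t$; put $$\sigma^t_h(\pi,g)=\mathbb E_{\mathcal D^t_h}\big[|\mathcal A|\,\pi_h(a_h\mid z_{h-1},o_h)\{r_h+g_{h+1}(z_h,t_{h+1})\}-g_h(z_{h-1},t_h)\big]$$ (an empirical mean) and let $(\pi^{t+1},g^{t+1})$ maximize the empirical mean $\mathbb E_{\mathcal D^0}[g_1(t_1)]$ over $\Pi\times\mathcal G$ subject to $\sigma^i_h(\pi,g)^2\le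 R$ for all $i\le t$, $h\le H$ (it is arbitrary if there is no maximizer). Return the policy $\hat\pi$ among $\pi^0,\dots,\pi^{T-1}$ whose empirical mean return $\sum_{h\le H} r_h$ in its on-policy data set is largest. Ties are broken arbitrarily. An episode here consists of $H+K$ steps, and the number of episodes used is $m+T(H+1)m$. **(3) Sample complexity.** There are absolute constants $c>0$, $p\in\mathbb N$ such that for all sizes $|\mathcal S|,|\mathcal O|,|\mathcal A|$, all $H,K\ge1$, $M\ge0$, $\sigma_1\in(0,1]$, $\varepsilon\in(0,H]$, $\delta\in(0,1)$ there are parameters $m,T\geq 1$ and $R$, which do not depend on the unknown POMDP, with $$m+T(H+1)m\le c\,\frac{|\mathcal A|^{3M+K+2}|\mathcal O|^{3M+K}|\mathcal S|^2H^6(1+\ln(1/\delta))}{\varepsilon^2\sigma_1^2}\;\Lambda^p,\qquad \Lambda=1+\ln\frac{|\mathcal S||\mathcal O|^{M+K}|\mathcal A|^{M+K}H^2(1+\ln(1/\delta))}{\varepsilon\,\sigma_1},$$ such that, for every POMDP as above and both classes $\mathcal G$, with probability at least $1-\delta$ the returned policy satisfies $J(\pi)-J(\hat\pi)\le\varepsilon$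 for all $\pi\in\Pi$. -/

import Mathlib

/-! Finite-state partially observable decision processes with `M`-memory policies, `K`-step futures,
value link functions, the optimistic actor-critic algorithm, and the law of its data.
Steps are numbered from `0`: step `h` here is step `h + 1` in the usual numbering. -/

namespace POMDPLearning

/-- Expectation of a real function under a probability mass function on a finite type. -/
noncomputable def expect {α : Type*} [Fintype α] (p : PMF α) (f : α → ℝ) : ℝ :=
  ∑ x, (p x).toReal * f x

/-- Law of independent draws, the `i`-th one from `q i`. -/
noncomputable def indep {α : Type*} : (n : ℕ) → (Fin n → PMF α) → PMF (Fin n → α)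
  | 0, _ => PMF.pure Fin.elim0
  | n + 1, q =>
    (q 0).bind fun x => (indep n fun i => q i.succ).map fun xs => Fin.cons x xs

/-- The Moore--Penrose inverse of a real matrix of full column rank. -/
noncomputable def pinv {m n : Type*} [Fintype m] [Fintype n] [DecidableEq n]
    (B : Matrix m n ℝ) : Matrix n m ℝ :=
  (B.transpose * B)⁻¹ * B.transpose

/-- The four Penrose identities, for matrices of full column rank. -/
theorem pinv_spec {m n : Type*} [Fintype m] [Fintype n] [DecidableEq n]
    (B : Matrix m n ℝ) (hB : B.rank = Fintype.card n) :
    pinv B * B = 1 ∧ B * pinv B * B = B ∧ pinv B * B * pinv B = pinv B ∧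
      (B * pinv B).transpose = B * pinv B := by
  have hu : IsUnit (B.transpose * B) := by
    rw [← Matrix.linearIndependent_cols_iff_isUnit, linearIndependent_iff_card_eq_finrank_span,
      Set.finrank, ← Matrix.rank_eq_finrank_span_cols, Matrix.rank_transpose_mul_self, hB]
  have hd : IsUnit (B.transpose * B).det := (Matrix.isUnit_iff_isUnit_det _).1 hu
  have h1 : pinv B * B = 1 := by
    rw [pinv, Matrix.mul_assoc, Matrix.nonsing_inv_mul _ hd]
  refine ⟨h1, ?_, ?_, ?_⟩
  · rw [Matrix.mul_assoc, h1, Matrix.mul_one]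
  · rw [h1, Matrix.one_mul]
  · rw [pinv, Matrix.transpose_mul, Matrix.transpose_mul, Matrix.transpose_transpose,
      Matrix.transpose_nonsing_inv, Matrix.transpose_mul, Matrix.transpose_transpose,
      Matrix.mul_assoc]

/-- The induced operator norm for the `1`-norms: the largest column sum of absolute values. -/
noncomputable def oneNorm {m n : Type*} [Fintype m] [Fintype n] (B : Matrix m n ℝ) : ℝ :=
  ⨆ j, ∑ i, |B i j|

/-- Memory available before the observation of step `h`: the last `min h M` pairs
(observation, action), the most recent one at index `0`. -/
abbrev Mem (O A : Type*) (M h : ℕ) := Fin (min h M) → O × A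

/-- The empty memory of the first step. -/
def emptyMem {O A : Type*} {M : ℕ} : Mem O A M 0 := fun i => (Fin.cast (Nat.zero_min M) i).elim0

/-- The memory after one more observation and action. -/
def pushMem {O A : Type*} {M h : ℕ} (z : Mem O A M h) (o : O) (a : A) : Mem O A M (h + 1) :=
  fun i => if hi : (i : ℕ) = 0 then (o, a) else z ⟨i - 1, by have := i.isLt; omega⟩

/-- The memory before step `h` in a sequence of observations and actions. -/
def memAt {O A : Type*} {n : ℕ} (M : ℕ) (x : Fin n → O × A) (h : ℕ) (hn : h ≤ n) : Mem O A M h :=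
  fun i => x ⟨h - 1 - i, by have := i.isLt; omega⟩

/-- `K`-step futures: `K` observations and the `K - 1` actions between them. -/
abbrev Fut (O A : Type*) (K : ℕ) := (Fin K → O) × (Fin (K - 1) → A)

/-- The `K`-step future from step `h` on, in a sequence of observations and actions. -/
def futAt {O A : Type*} {n : ℕ} (K : ℕ) (x : Fin n → O × A) (h : ℕ) (hn : h + K ≤ n) :
    Fut O A K :=
  (fun i => (x ⟨h + i, by have := i.isLt; omega⟩).1,
    fun i => (x ⟨h + i, by have := i.isLt; omega⟩).2)

/-- `M`-memory policies: at each step, a law on actions given the memory and the current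
observation. -/
abbrev Policy (O A : Type*) (M : ℕ) := (h : ℕ) → Mem O A M h → O → PMF A

/-- The policy of uniform independent actions. -/
noncomputable def unifPolicy (O A : Type*) [Fintype A] [Nonempty A] (M : ℕ) : Policy O A M :=
  fun _ _ _ => PMF.uniformOfFintype A

/-- Follow `π'` before step `h`, and take uniform actions from step `h` on. -/
noncomputable def thenUnif {O A : Type*} [Fintype A] [Nonempty A] {M : ℕ}
    (π' : Policy O A M) (h : ℕ) : Policy O A M :=
  fun j => if j < h then π' j else unifPolicy O A M j

/-- Follow `π'` before step `h`, `π` at step `h`, and take uniform actions afterwards. -/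
noncomputable def thenOneThenUnif {O A : Type*} [Fintype A] [Nonempty A] {M : ℕ}
    (π' : Policy O A M) (h : ℕ) (π : Policy O A M) : Policy O A M :=
  fun j => if j < h then π' j else if j = h then π j else unifPolicy O A M j

/-- Functions of the memory and the `K`-step future, one for each step. -/
abbrev Link (O A : Type*) (M K : ℕ) := (h : ℕ) → Mem O A M h → Fut O A K → ℝ

/-- What the learner sees of an episode of `N` steps: observations, actions and rewards. -/
abbrev Episode (O A : Type*) (N : ℕ) := (Fin N → O × A) × (Fin N → ℝ)

/-- A data set of `m` episodes. -/
abbrev Batch (O A : Type*) (N m : ℕ) := Fin m → Episode O A N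

/-- The data of one iteration: `H + 1` data sets. -/
abbrev Round (O A : Type*) (N H m : ℕ) := Fin (H + 1) → Batch O A N m

/-- A POMDP with latent states `S`, observations `O` and actions `A`; transitions and emissions
are time-homogeneous. -/
structure POMDP (S O A : Type*) where
  init : PMF S
  trans : S → A → PMF S
  emit : S → PMF O
  reward : ℕ → S → O → A → ℝ

namespace POMDP

variable {S O A : Type*} (P : POMDP S O A)

/-- Law of `n` consecutive steps (latent state, observation, action) from step `h` on, when the
memory is `z`, the latent state is `s`, and actions follow `π`. -/
noncomputable def rollout {M : ℕ} (π : Policy O A M) :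
    (n h : ℕ) → Mem O A M h → S → PMF (Fin n → S × O × A)
  | 0, _, _, _ => PMF.pure Fin.elim0
  | n + 1, h, z, s =>
    (P.emit s).bind fun o => (π h z o).bind fun a => (P.trans s a).bind fun s' =>
      (rollout π n (h + 1) (pushMem z o a) s').map fun τ => Fin.cons (s, o, a) τ

/-- Law of the first `N` steps under `π`. -/
noncomputable def traj {M : ℕ} (π : Policy O A M) (N : ℕ) : PMF (Fin N → S × O × A) :=
  P.init.bind fun s => P.rollout π N 0 emptyMem s

/-- Observations and actions of a latent trajectory. -/
def obs {n : ℕ} (τ : Fin n → S × O × A) : Fin n → O × A := fun i => (τ i).2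

/-- Reward received at the `i`-th entry of a trajectory that starts at step `h`. -/
def rew {n : ℕ} (h : ℕ) (τ : Fin n → S × O × A) (i : Fin n) : ℝ :=
  P.reward (h + i) (τ i).1 (τ i).2.1 (τ i).2.2

/-- Law of an observed episode of `N` steps under `π`. -/
noncomputable def episode {M : ℕ} (π : Policy O A M) (N : ℕ) : PMF (Episode O A N) :=
  (P.traj π N).map fun τ => (obs τ, P.rew 0 τ)

/-- The `K`-step observation matrix: the entry at `(t, s)` is the probability of the `K`-step
future `t` from the latent state `s` under uniform actions. -/
noncomputable def obsMatrix [Fintype A] [Nonempty A] (K : ℕ) : Matrix (Fut O A K) S ℝ :=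
  fun t s => (((P.rollout (unifPolicy O A 0) K 0 emptyMem s).map
    fun τ => futAt K (obs τ) 0 (by omega)) t).toReal

variable [Fintype S] [Fintype O] [Fintype A]

/-- Expected total reward of the `H` steps of an episode under `π`. -/
noncomputable def J {M : ℕ} (H : ℕ) (π : Policy O A M) : ℝ :=
  expect (P.traj π H) fun τ => ∑ i, P.rew 0 τ i

/-- Expected reward from step `h` to the horizon, given the memory and the latent state. -/
noncomputable def V {M : ℕ} (H : ℕ) (π : Policy O A M) (h : ℕ) (z : Mem O A M h) (s : S) : ℝ :=
  expect (P.rollout π (H - h) h z s) fun τ => ∑ i, P.rew h τ i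

variable [Nonempty A] {M K : ℕ}

/-- `g` is a `K`-step value link function of `π` for uniform future actions. -/
def IsValueLink (H : ℕ) (π : Policy O A M) (g : Link O A M K) : Prop :=
  ∀ h < H, ∀ (z : Mem O A M h) (s : S),
    expect (P.rollout (unifPolicy O A M) K h z s)
      (fun τ => g h z (futAt K (obs τ) 0 (by omega))) = P.V H π h z s

/-- The Bellman error of `(π, g)` at step `h` under roll-in by `π'`, with uniform actions in the
`K`-step futures. -/
noncomputable def bellmanError {H : ℕ} (π : Policy O A M) (g : Link O A M K)
    (π' : Policy O A M) (h : Fin H) : ℝ :=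
  expect (P.traj (thenUnif π' h) (H + K)) (fun τ =>
      g h (memAt M (obs τ) h (by omega)) (futAt K (obs τ) h (by omega)))
    - expect (P.traj (thenOneThenUnif π' h π) (H + K)) (fun τ =>
      P.rew 0 τ ⟨h, by omega⟩ +
        g (h + 1) (memAt M (obs τ) (h + 1) (by omega)) (futAt K (obs τ) (h + 1) (by omega)))

/-- The link functions `(z, t) ↦ ⟨θ, 𝟏(z) ⊗ 𝕆† 𝟏(t)⟩` with `‖θ‖_∞ ≤ H`, where `𝕆` is the `K`-step
observation matrix; zero beyond the horizon. -/
def linkClass [DecidableEq S] (H M K : ℕ) : Set (Link O A M K) :=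
  {g | (∀ h < H, ∃ θ : Mem O A M h → S → ℝ, (∀ z s, |θ z s| ≤ H) ∧
      ∀ z t, g h z t = ∑ s, θ z s * pinv (P.obsMatrix K) s t) ∧ ∀ h ≥ H, g h = 0}

/-- The model with all `M`-memory policies and link functions `G` is PO-bilinear of rank at most
`d`, with norm bounds `BX` and `BW`. -/
def IsPOBilinear (H : ℕ) (G : Set (Link O A M K)) (d : ℕ) (BX BW : ℝ) : Prop :=
  (∀ π : Policy O A M, ∃ g ∈ G, P.IsValueLink H π g) ∧
  ∃ (W : Fin H → Policy O A M → Link O A M K → EuclideanSpace ℝ (Fin d))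
    (X : Fin H → Policy O A M → EuclideanSpace ℝ (Fin d)),
    (∀ h π, ∀ g ∈ G, ∀ π', P.bellmanError π g π' h = inner ℝ (W h π g) (X h π')) ∧
    (∀ h π, ∀ g ∈ G, P.IsValueLink H π g → W h π g = 0) ∧
    (∀ h π, ‖X h π‖ ≤ BX) ∧
    (∀ h π, ∀ g ∈ G, ‖W h π g‖ ≤ BW)

end POMDP

/-- All link functions with values in `[-B, B]`; zero beyond the horizon. -/
def boundedLinks (O A : Type*) (H M K : ℕ) (B : ℝ) : Set (Link O A M K) :=
  {g | (∀ h < H, ∀ z t, |g h z t| ≤ B) ∧ ∀ h ≥ H, g h = 0}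

section Algorithm

variable {O A : Type*} [Fintype A] {H M K m : ℕ}

/-- Importance-weighted temporal-difference loss of `(π, g)` at step `h` on an episode in which
the action of step `h` is uniform. -/
noncomputable def tdLoss (π : Policy O A M) (g : Link O A M K) (h : Fin H)
    (e : Episode O A (H + K)) : ℝ :=
  (Fintype.card A : ℝ) *
      (π h (memAt M e.1 h (by omega)) (e.1 ⟨h, by omega⟩).1 (e.1 ⟨h, by omega⟩).2).toReal *
      (e.2 ⟨h, by omega⟩ +
        g (h + 1) (memAt M e.1 (h + 1) (by omega)) (futAt K e.1 (h + 1) (by omega)))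
    - g h (memAt M e.1 h (by omega)) (futAt K e.1 h (by omega))

/-- The empirical loss on a data set. -/
noncomputable def empLoss (π : Policy O A M) (g : Link O A M K) (h : Fin H)
    (D : Batch O A (H + K) m) : ℝ :=
  (∑ i, tdLoss π g h (D i)) / m

/-- The empirical mean of the first-step link function. -/
noncomputable def empInit (g : Link O A M K) (D : Batch O A (H + K) m) : ℝ :=
  (∑ i, g 0 emptyMem (futAt K (D i).1 0 (by omega))) / m

/-- The empirical mean of the total reward of the first `H` steps. -/
noncomputable def empReturn (D : Batch O A (H + K) m) : ℝ :=
  (∑ i, ∑ j : Fin H, (D i).2 ⟨j, by omega⟩) / m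

/-- Pairs in the class whose squared empirical losses are at most `R` on all data sets so far. -/
def Feasible {t : ℕ} (G : Set (Link O A M K)) (R : ℝ) (D : Fin t → Round O A (H + K) H m)
    (x : Policy O A M × Link O A M K) : Prop :=
  x.2 ∈ G ∧ ∀ i (h : Fin H), (empLoss x.1 x.2 h (D i h.castSucc)) ^ 2 ≤ R

/-- The optimistic choices given the data: the solutions of the constrained maximization. -/
def Optimistic {t : ℕ} (G : Set (Link O A M K)) (R : ℝ) (D₀ : Batch O A (H + K) m)
    (D : Fin t → Round O A (H + K) H m) (x : Policy O A M × Link O A M K) : Prop :=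
  Feasible G R D x ∧ ∀ y, Feasible G R D y → empInit y.2 D₀ ≤ empInit x.2 D₀

/-- An implementation of the algorithm with `T` iterations: an initial policy, an optimistic
selection (arbitrary when the constrained maximization has no solution), and a final choice of an
iterate with the largest empirical return. Ties are broken in an arbitrary way. -/
structure Learner (O A : Type*) [Fintype A] (H M K m T : ℕ) (G : Set (Link O A M K)) (R : ℝ) where
  initial : Policy O A M
  select : Batch O A (H + K) m → (t : ℕ) → (Fin (t + 1) → Round O A (H + K) H m) →
    Policy O A M × Link O A M K
  select_optimistic : ∀ (D₀ : Batch O A (H + K) m) (t : ℕ)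
    (D : Fin (t + 1) → Round O A (H + K) H m),
    (∃ x, Optimistic G R D₀ D x) → Optimistic G R D₀ D (select D₀ t D)
  choose : Batch O A (H + K) m → (Fin T → Round O A (H + K) H m) → Fin T
  choose_best : ∀ (D₀ : Batch O A (H + K) m) (D : Fin T → Round O A (H + K) H m) (t : Fin T),
    empReturn (D t (Fin.last H)) ≤ empReturn (D (choose D₀ D) (Fin.last H))

namespace Learner

variable {T : ℕ} {G : Set (Link O A M K)} {R : ℝ} (L : Learner O A H M K m T G R)

/-- The policy of iteration `t`, from the data of the iterations before. -/
def policyAt (D₀ : Batch O A (H + K) m) :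
    (t : ℕ) → (Fin t → Round O A (H + K) H m) → Policy O A M
  | 0, _ => L.initial
  | t + 1, D => (L.select D₀ t D).1

/-- The policy that is returned. -/
def output (D₀ : Batch O A (H + K) m) (D : Fin T → Round O A (H + K) H m) : Policy O A M :=
  L.policyAt D₀ (L.choose D₀ D) fun i => D (Fin.castLE (L.choose D₀ D).isLt.le i)

variable {S : Type*} [Nonempty A] (P : POMDP S O A)

/-- Law of the data of an iteration with policy `π`: for each `h ≤ H`, `m` independent episodes
with actions from `π` before step `h` and uniform actions from step `h` on. -/
noncomputable def roundLaw (H K m : ℕ) (π : Policy O A M) : PMF (Round O A (H + K) H m) :=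
  indep (H + 1) fun h => indep m fun _ => P.episode (thenUnif π h) (H + K)

/-- Law of the data of the first `t` iterations, with the initial data set, in which all actions
are uniform. -/
noncomputable def dataLaw :
    (t : ℕ) → PMF (Batch O A (H + K) m × (Fin t → Round O A (H + K) H m))
  | 0 => (indep m fun _ => P.episode (unifPolicy O A M) (H + K)).map fun D₀ => (D₀, Fin.elim0)
  | t + 1 =>
    (dataLaw t).bind fun ω =>
      (roundLaw P H K m (L.policyAt ω.1 t ω.2)).map fun X => (ω.1, Fin.snoc ω.2 X)

end Learner

/-- Number of episodes drawn: the initial data set, and `H + 1` data sets in each iteration. -/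
def numEpisodes (H m T : ℕ) : ℕ := m + T * ((H + 1) * m)

end Algorithm

end POMDPLearning

/-! Both halves rest on one identity. From step `h` on, an episode depends on its past only through
the memory and the latent state, and under uniform actions the `K`-step future depends on the latent
state alone (`expect_traj_window`, `expect_rollout_futAt`). So the Bellman error of `(π, g)` under
roll-in by `π'` is the pairing of the law of (memory, state) under `π'` with the residual of `(π,
g)` (`bellmanError_eq`): a bilinear form whose rank is at most the number of such pairs. By the
Bellman equation the residual of a value link is zero. Full column rank supplies value links: the
Moore–Penrose inverse, weighted by the value function, has that function as its conditional mean
(`futMean_pinv`).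

For learning, three facts are combined on an event of probability at least `1 - δ`. Concentration:
the loss is affine separately in the policy entries, the next link and the current link, so its
deviations over the whole infinite class are controlled by the finitely many vertices of a box
(`abs_deviation_le_of_vertices`), and a union bound suffices. Optimism: value links meet the
constraints, so the initial value predicted by the selected link is at least `J π - 2η` for every
`π` (`select_spec`). Compactness ensures that a maximizer exists. Elliptical potential: each
selected pair has small Bellman errors under all earlier policies, hence some iterate has small
errors under its own policy (`exists_sum_bellmanError_sq_le`). On-policy Bellman errors telescope to
predicted minus actual return (`sum_bellmanError`), so that iterate is nearly optimal, and comparing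
empirical returns costs only another `2η` (`suboptimality_le`). -/

namespace POMDPLearning

open Finset

/-! ### Expectations under laws on finite types. -/

section Expect

variable {α β : Type*} [Fintype α] [Fintype β]

theorem expect_def (p : PMF α) (f : α → ℝ) : expect p f = ∑ x, (p x).toReal * f x := rfl

theorem sum_toReal_eq_one (p : PMF α) : ∑ x, (p x).toReal = 1 := by
  rw [← ENNReal.toReal_sum fun x _ => p.apply_ne_top x, ← tsum_fintype (L := .unconditional _),
    p.tsum_coe, ENNReal.toReal_one]

theorem expect_const (p : PMF α) (c : ℝ) : (expect p fun _ => c) = c := by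
  rw [expect_def, ← sum_mul, sum_toReal_eq_one, one_mul]

theorem expect_pure (x : α) (f : α → ℝ) : expect (PMF.pure x) f = f x := by
  classical
  simp [expect_def, PMF.pure_apply, apply_ite ENNReal.toReal, ite_mul]

theorem expect_bind (p : PMF α) (q : α → PMF β) (f : β → ℝ) :
    expect (p.bind q) f = expect p fun x => expect (q x) f := by
  have h : ∀ y, ((p.bind q) y).toReal = ∑ x, (p x).toReal * (q x y).toReal := by
    intro y
    rw [PMF.bind_apply, tsum_fintype, ENNReal.toReal_sum fun x _ =>
      ENNReal.mul_ne_top (p.apply_ne_top x) ((q x).apply_ne_top y)]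
    simp only [ENNReal.toReal_mul]
  simp only [expect_def, h, sum_mul, mul_sum]
  rw [sum_comm]
  simp only [mul_assoc]

theorem expect_map (p : PMF α) (φ : α → β) (f : β → ℝ) :
    expect (p.map φ) f = expect p fun x => f (φ x) := by
  rw [PMF.map, expect_bind]
  simp only [Function.comp_apply, expect_pure]

theorem expect_congr (p : PMF α) {f g : α → ℝ} (h : ∀ x, f x = g x) : expect p f = expect p g := by
  rw [funext h]

theorem expect_mono (p : PMF α) {f g : α → ℝ} (h : ∀ x, f x ≤ g x) : expect p f ≤ expect p g :=
  sum_le_sum fun x _ => mul_le_mul_of_nonneg_left (h x) ENNReal.toReal_nonneg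

theorem expect_nonneg (p : PMF α) {f : α → ℝ} (h : ∀ x, 0 ≤ f x) : 0 ≤ expect p f :=
  sum_nonneg fun x _ => mul_nonneg ENNReal.toReal_nonneg (h x)

theorem expect_add (p : PMF α) (f g : α → ℝ) :
    (expect p fun x => f x + g x) = expect p f + expect p g := by
  simp only [expect_def, mul_add, sum_add_distrib]

theorem expect_sub (p : PMF α) (f g : α → ℝ) :
    (expect p fun x => f x - g x) = expect p f - expect p g := by
  simp only [expect_def, mul_sub, sum_sub_distrib]

theorem expect_mul_left (p : PMF α) (c : ℝ) (f : α → ℝ) :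
    (expect p fun x => c * f x) = c * expect p f := by
  simp only [expect_def, mul_sum, mul_left_comm]

theorem expect_mul_right (p : PMF α) (c : ℝ) (f : α → ℝ) :
    (expect p fun x => f x * c) = expect p f * c := by
  simp only [expect_def, sum_mul, mul_assoc]

theorem abs_expect_le (p : PMF α) {f : α → ℝ} {C : ℝ} (h : ∀ x, |f x| ≤ C) : |expect p f| ≤ C := by
  rw [abs_le]
  constructor
  · rw [← expect_const p (-C)]
    exact expect_mono p fun x => (abs_le.1 (h x)).1
  · conv_rhs => rw [← expect_const p C]
    exact expect_mono p fun x => (abs_le.1 (h x)).2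

theorem expect_uniformOfFintype [Nonempty α] (f : α → ℝ) :
    expect (PMF.uniformOfFintype α) f = (Fintype.card α : ℝ)⁻¹ * ∑ x, f x := by
  simp [expect_def, mul_sum]

theorem toOuterMeasure_eq_expect (p : PMF α) (s : Set α) :
    p.toOuterMeasure s = ENNReal.ofReal (expect p (s.indicator 1)) := by
  rw [PMF.toOuterMeasure_apply_fintype, expect_def,
    ENNReal.ofReal_sum_of_nonneg fun x _ => mul_nonneg ENNReal.toReal_nonneg
      (Set.indicator_nonneg (f := (1 : α → ℝ)) (fun _ _ => zero_le_one) x)]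
  refine sum_congr rfl fun x _ => ?_
  by_cases hx : x ∈ s
  · simp [hx, ENNReal.ofReal_toReal (p.apply_ne_top x)]
  · simp [hx]

end Expect

/-! ### Independent draws: images, marginals, products. -/

section Indep

variable {α β : Type*}

theorem indep_map {n : ℕ} (q : Fin n → PMF α) (φ : α → β) :
    (indep n fun i => (q i).map φ) = (indep n q).map fun x i => φ (x i) := by
  induction n with
  | zero =>
    rw [indep, indep, PMF.pure_map]
    congr 1
    exact Subsingleton.elim _ _
  | succ n ih =>
    simp only [indep, ih, PMF.map_bind, PMF.bind_map, PMF.map_comp]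
    refine congrArg _ (funext fun x => ?_)
    simp only [Function.comp_apply]
    refine congrArg (fun ψ => PMF.map ψ _) (funext fun y => funext fun i => ?_)
    cases i using Fin.cases <;> simp

theorem indep_map_apply {n : ℕ} (q : Fin n → PMF α) (i : Fin n) :
    (indep n q).map (fun x => x i) = q i := by
  induction n with
  | zero => exact i.elim0
  | succ n ih =>
    simp only [indep, PMF.map_bind, PMF.map_comp]
    cases i using Fin.cases with
    | zero =>
      have : ∀ x : α, (fun xs : Fin n → α => (Fin.cons x xs : Fin (n + 1) → α) 0) =
        Function.const _ x := fun x => rfl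
      simp only [Function.comp_def, this, PMF.map_const, PMF.bind_pure]
    | succ i =>
      have : ∀ x : α, (fun xs : Fin n → α => (Fin.cons x xs : Fin (n + 1) → α) i.succ) =
        fun xs => xs i := fun x => funext fun xs => Fin.cons_succ _ _ _
      simp only [Function.comp_def, this, ih, PMF.bind_const]

theorem expect_indep_prod [Fintype α] (p : PMF α) (φ : α → ℝ) (n : ℕ) :
    (expect (indep n fun _ => p) fun x => ∏ i, φ (x i)) = expect p φ ^ n := by
  induction n with
  | zero => simp [indep, expect_pure]
  | succ n ih =>
    simp only [indep, expect_bind, expect_map, Fin.prod_univ_succ, Fin.cons_zero, Fin.cons_succ,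
      expect_mul_left, ih, expect_mul_right]
    rw [pow_succ, mul_comm]

end Indep

/-! ### Hoeffding-type bounds for empirical means. -/

section Concentration

/-- For a centred variable the linear term averages out, which leaves a sub-Gaussian bound. If `|x|
≤ 1`, use `e^x ≤ 1 + x + x²`; if `x ≤ -1`, the right side is at least `1 + x + x² ≥ 1`. -/
theorem exp_le_add_exp_sq (x : ℝ) : Real.exp x ≤ x + Real.exp (x ^ 2) := by
  have h2 := Real.add_one_le_exp (x ^ 2)
  rcases le_total |x| 1 with h | h
  · have := (abs_le.1 (Real.abs_exp_sub_one_sub_id_le h)).2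
    linarith
  · rcases le_abs'.1 h with h | h
    · have : Real.exp x ≤ 1 := Real.exp_le_one_iff.2 (by linarith)
      nlinarith
    · have : Real.exp x ≤ Real.exp (x ^ 2) := Real.exp_le_exp.2 (by nlinarith)
      linarith

variable {α : Type*} [Fintype α]

theorem expect_exp_le (p : PMF α) {f : α → ℝ} {c : ℝ} (hf : ∀ x, |f x| ≤ c) (h0 : expect p f = 0)
    (l : ℝ) : (expect p fun x => Real.exp (l * f x)) ≤ Real.exp (l ^ 2 * c ^ 2) := by
  calc (expect p fun x => Real.exp (l * f x))
      ≤ expect p fun x => l * f x + Real.exp (l ^ 2 * c ^ 2) := by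
        refine expect_mono p fun x => (exp_le_add_exp_sq _).trans ?_
        have : (f x) ^ 2 ≤ c ^ 2 := sq_le_sq' (abs_le.1 (hf x)).1 (abs_le.1 (hf x)).2
        have : (l * f x) ^ 2 ≤ l ^ 2 * c ^ 2 := by
          rw [mul_pow]
          exact mul_le_mul_of_nonneg_left this (sq_nonneg l)
        linarith [Real.exp_le_exp.2 this]
    _ = Real.exp (l ^ 2 * c ^ 2) := by
        rw [expect_add, expect_mul_left, h0, expect_const]
        ring

theorem prob_mean_ge_le (p : PMF α) {f : α → ℝ} {C η : ℝ} (hC : 0 < C) (hη : 0 < η)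
    (hf : ∀ x, |f x| ≤ C) {m : ℕ} (hm : 0 < m) :
    (indep m fun _ => p).toOuterMeasure {x | expect p f + η < (∑ i, f (x i)) / m} ≤
      ENNReal.ofReal (Real.exp (-(m * η ^ 2 / (16 * C ^ 2)))) := by
  rw [toOuterMeasure_eq_expect]
  refine ENNReal.ofReal_le_ofReal ?_
  -- Minimizer of the Chernoff exponent `4 C² l² - l η`; centring has doubled the bound `C` to `2
  -- C`.
  set l : ℝ := η / (8 * C ^ 2) with hl
  have hl0 : 0 < l := by positivity
  have hm' : (0 : ℝ) < m := by exact_mod_cast hm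
  set μ := expect p f with hμ
  have hμC : |μ| ≤ C := abs_expect_le p hf
  have hc : ∀ x, |f x - μ| ≤ 2 * C := fun x => by
    have := abs_sub (f x) μ
    linarith [hf x]
  have h0 : (expect p fun x => f x - μ) = 0 := by rw [expect_sub, expect_const, sub_self]
  calc expect (indep m fun _ => p) ({x | μ + η < (∑ i, f (x i)) / m}.indicator 1)
      ≤ expect (indep m fun _ => p) fun x =>
          (∏ i, Real.exp (l * (f (x i) - μ))) * Real.exp (-(l * m * η)) := by
        refine expect_mono _ fun x => ?_
        rw [← Real.exp_sum, ← Real.exp_add]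
        by_cases hx : μ + η < (∑ i, f (x i)) / m
        · rw [Set.indicator_of_mem (by exact hx), Pi.one_apply]
          refine Real.one_le_exp ?_
          rw [← mul_sum, sum_sub_distrib, sum_const, card_univ, Fintype.card_fin, nsmul_eq_mul]
          rw [lt_div_iff₀ hm'] at hx
          nlinarith
        · rw [Set.indicator_of_notMem (by exact hx)]
          positivity
    _ ≤ Real.exp (l ^ 2 * (2 * C) ^ 2) ^ m * Real.exp (-(l * m * η)) := by
        rw [expect_mul_right, expect_indep_prod p fun y => Real.exp (l * (f y - μ))]
        refine mul_le_mul_of_nonneg_right (pow_le_pow_left₀ (expect_nonneg _ fun x =>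
          (Real.exp_pos _).le) (expect_exp_le p hc h0 l) m) (Real.exp_pos _).le
    _ = Real.exp (-(m * η ^ 2 / (16 * C ^ 2))) := by
        rw [← Real.exp_nat_mul, ← Real.exp_add, hl]
        congr 1
        field_simp
        ring

theorem prob_mean_sub_le (p : PMF α) {f : α → ℝ} {C η : ℝ} (hC : 0 < C) (hη : 0 < η)
    (hf : ∀ x, |f x| ≤ C) {m : ℕ} (hm : 0 < m) :
    (indep m fun _ => p).toOuterMeasure {x | η < |(∑ i, f (x i)) / m - expect p f|} ≤
      ENNReal.ofReal (2 * Real.exp (-(m * η ^ 2 / (16 * C ^ 2)))) := by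
  have h1 := prob_mean_ge_le p hC hη hf hm
  have h2 := prob_mean_ge_le p (f := fun x => -f x) hC hη (by simpa using hf) hm
  rw [two_mul, ENNReal.ofReal_add (Real.exp_pos _).le (Real.exp_pos _).le]
  refine le_trans (le_trans (MeasureTheory.measure_mono ?_) (MeasureTheory.measure_union_le _ _))
    (add_le_add h1 h2)
  intro x hx
  rcases lt_abs.1 hx.out with h | h
  · left
    simp only [Set.mem_ofPred_eq]
    linarith
  · right
    have : (expect p fun x => -f x) = -expect p f := by simp [expect_def]
    simp only [Set.mem_ofPred_eq, this, sum_neg_distrib, neg_div]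
    linarith

theorem prob_exists_mean_sub_le {ι : Type*} [Finite ι] (p : PMF α) {f : ι → α → ℝ} {C η : ℝ}
    (hC : 0 < C) (hη : 0 < η) (hf : ∀ j x, |f j x| ≤ C) {m : ℕ} (hm : 0 < m) :
    (indep m fun _ => p).toOuterMeasure
        {x | ∃ j, η < |(∑ i, f j (x i)) / m - expect p (f j)|} ≤
      ENNReal.ofReal (Nat.card ι * (2 * Real.exp (-(m * η ^ 2 / (16 * C ^ 2))))) := by
  have := Fintype.ofFinite ι
  rw [Set.ofPred_exists, Nat.card_eq_fintype_card]
  refine (MeasureTheory.measure_iUnion_fintype_le _ _).trans ?_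
  refine (sum_le_sum fun j _ => prob_mean_sub_le p hC hη (hf j) hm).trans ?_
  rw [sum_const, card_univ, nsmul_eq_mul, ENNReal.ofReal_mul (Nat.cast_nonneg _),
    ENNReal.ofReal_natCast]

end Concentration

/-! ### Union bounds for adaptively drawn data. -/

section Prob

theorem toOuterMeasure_univ {α : Type*} (p : PMF α) : p.toOuterMeasure Set.univ = 1 := by
  rw [PMF.toOuterMeasure_apply_eq_one_iff]
  exact Set.subset_univ _

/-- Condition on the past: off the bad past `b` the conditional failure probability is at most `c`,
and on `b` it is bounded by `1`. -/
theorem toOuterMeasure_bind_le_add {α β : Type*} (p : PMF α) (q : α → PMF β) (s : Set β)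
    (b : Set α) (c : ENNReal) (h : ∀ x ∉ b, (q x).toOuterMeasure s ≤ c) :
    (p.bind q).toOuterMeasure s ≤ p.toOuterMeasure b + c := by
  have h1 : ∀ x, p x * (q x).toOuterMeasure s ≤ b.indicator p x + p x * c := by
    intro x
    by_cases hx : x ∈ b
    · rw [Set.indicator_of_mem hx]
      refine le_add_right (mul_le_of_le_one_right' ?_)
      exact toOuterMeasure_univ (q x) ▸ MeasureTheory.measure_mono (Set.subset_univ s)
    · exact le_add_left (mul_le_mul_right (h x hx) _)
  rw [PMF.toOuterMeasure_bind_apply, PMF.toOuterMeasure_apply]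
  refine (ENNReal.tsum_le_tsum h1).trans ?_
  rw [ENNReal.tsum_add, ENNReal.tsum_mul_right, p.tsum_coe, one_mul]

theorem le_toOuterMeasure_of_compl {α : Type*} (p : PMF α) (s : Set α) {δ : ℝ} (h0 : 0 ≤ δ)
    (h : p.toOuterMeasure sᶜ ≤ ENNReal.ofReal δ) : ENNReal.ofReal (1 - δ) ≤ p.toOuterMeasure s := by
  rw [ENNReal.ofReal_sub _ h0, ENNReal.ofReal_one, tsub_le_iff_right, ← toOuterMeasure_univ p,
    ← Set.union_compl_self s]
  exact (MeasureTheory.measure_union_le _ _).trans (add_le_add_right h _)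

end Prob

/-! ### Memories, futures and the Markov structure of trajectories. -/

section Sequences

variable {O A X : Type*} {M : ℕ}

/-- The `n` entries from position `h` on. -/
def window {N : ℕ} (x : Fin N → X) (h n : ℕ) (hn : h + n ≤ N) : Fin n → X :=
  fun i => x ⟨h + i, by have := i.isLt; omega⟩

theorem memAt_zero {n : ℕ} (x : Fin n → O × A) (hn : 0 ≤ n) : memAt M x 0 hn = emptyMem := by
  funext i
  exact absurd i.isLt (by simp)

theorem memAt_succ {n : ℕ} (x : Fin n → O × A) (h : ℕ) (hn : h + 1 ≤ n) :
    memAt M x (h + 1) hn =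
      pushMem (memAt M x h (by omega)) (x ⟨h, by omega⟩).1 (x ⟨h, by omega⟩).2 := by
  funext i
  rw [pushMem]
  split_ifs with hi
  · simp [memAt, hi]
  · simp only [memAt]
    congr 2
    omega

theorem futAt_congr {N N' K : ℕ} (x : Fin N → O × A) (y : Fin N' → O × A) (h h' : ℕ)
    (hh : h + K ≤ N) (hh' : h' + K ≤ N')
    (hxy : ∀ i (hi : i < K), x ⟨h + i, by omega⟩ = y ⟨h' + i, by omega⟩) :
    futAt K x h hh = futAt K y h' hh' := by
  refine Prod.ext (funext fun i => ?_) (funext fun i => ?_)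
  · exact congrArg Prod.fst (hxy i i.isLt)
  · exact congrArg Prod.snd (hxy i (by have := i.isLt; omega))

end Sequences

namespace POMDP

variable {S O A : Type*} (P : POMDP S O A) {M K : ℕ}

theorem rollout_congr {π π' : Policy O A M} (n h : ℕ) (z : Mem O A M h) (s : S)
    (hπ : ∀ j, h ≤ j → j < h + n → π j = π' j) : P.rollout π n h z s = P.rollout π' n h z s := by
  induction n generalizing h s with
  | zero => rfl
  | succ n ih =>
    have : ∀ z' s', P.rollout π n (h + 1) z' s' = P.rollout π' n (h + 1) z' s' := fun z' s' =>
      ih (h + 1) z' s' fun j h1 h2 => hπ j (by omega) (by omega)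
    simp only [rollout, this, hπ h le_rfl (by omega)]

theorem rollout_take (π : Policy O A M) {k n : ℕ} (hk : k ≤ n) (h : ℕ) (z : Mem O A M h) (s : S) :
    (P.rollout π n h z s).map (fun τ (i : Fin k) => τ (Fin.castLE hk i)) = P.rollout π k h z s := by
  induction k generalizing n h s with
  | zero =>
    have : (fun (τ : Fin n → S × O × A) (i : Fin 0) => τ (Fin.castLE hk i)) =
        Function.const _ Fin.elim0 := funext fun τ => Subsingleton.elim _ _
    rw [this, PMF.map_const, rollout]
  | succ k ih =>
    obtain ⟨n, rfl⟩ : ∃ n', n = n' + 1 := ⟨n - 1, by omega⟩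
    simp only [rollout, PMF.map_bind, PMF.map_comp]
    congr! 7 with o a s'
    rw [← ih (Nat.le_of_succ_le_succ hk), PMF.map_comp]
    congr 1
    funext τ i
    cases i using Fin.cases <;> rfl

/-- Uniform actions ignore memory and step, and the dynamics are time-homogeneous. This identifies
futures at every step with the columns of `obsMatrix`, which is defined at step `0` with memory
length `0`. -/
theorem rollout_unifPolicy [Fintype A] [Nonempty A] {M' : ℕ} (n h h' : ℕ) (z : Mem O A M h)
    (z' : Mem O A M' h') (s : S) :
    P.rollout (unifPolicy O A M) n h z s = P.rollout (unifPolicy O A M') n h' z' s := by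
  induction n generalizing h h' s with
  | zero => rfl
  | succ n ih =>
    simp only [rollout, unifPolicy]
    congr! 7 with o a s'
    exact ih _ _ _ _ _

/-- Law of the memory and the latent state at step `h`. -/
noncomputable def occupancy (π : Policy O A M) : (h : ℕ) → PMF (Mem O A M h × S)
  | 0 => P.init.map fun s => (emptyMem, s)
  | h + 1 => (occupancy π h).bind fun x => (P.emit x.2).bind fun o => (π h x.1 o).bind fun a =>
      (P.trans x.2 a).map fun s' => (pushMem x.1 o a, s')

theorem occupancy_congr {π π' : Policy O A M} (h : ℕ) (hπ : ∀ j < h, π j = π' j) :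
    P.occupancy π h = P.occupancy π' h := by
  induction h with
  | zero => rfl
  | succ h ih => simp only [occupancy, ih fun j hj => hπ j (by omega), hπ h (by omega)]

variable [Fintype S] [Fintype O] [Fintype A]

theorem expect_rollout_succ (π : Policy O A M) (n h : ℕ) (z : Mem O A M h) (s : S)
    (F : (Fin (n + 1) → S × O × A) → ℝ) :
    expect (P.rollout π (n + 1) h z s) F =
      expect (P.emit s) fun o => expect (π h z o) fun a => expect (P.trans s a) fun s' =>
        expect (P.rollout π n (h + 1) (pushMem z o a) s') fun τ => F (Fin.cons (s, o, a) τ) := by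
  simp only [rollout, expect_bind, expect_map]

theorem expect_traj (π : Policy O A M) (n : ℕ) (F : (Fin n → S × O × A) → ℝ) :
    expect (P.traj π n) F = expect P.init fun s => expect (P.rollout π n 0 emptyMem s) F := by
  rw [traj, expect_bind]

/-- Markov property of the pair (memory, latent state). The induction hypothesis is applied to a
window longer by one, whose first entry updates the memory. -/
theorem expect_traj_window (π : Policy O A M) {N : ℕ} (h n : ℕ) (hN : h + n = N)
    (F : Mem O A M h → (Fin n → S × O × A) → ℝ) :
    (expect (P.traj π N) fun τ => F (memAt M (obs τ) h (by omega)) (window τ h n hN.le)) =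
      expect (P.occupancy π h) fun x => expect (P.rollout π n h x.1 x.2) (F x.1) := by
  induction h generalizing n with
  | zero =>
    obtain rfl : n = N := by omega
    rw [occupancy, expect_map, expect_traj]
    refine expect_congr _ fun s => expect_congr _ fun τ => ?_
    rw [memAt_zero]
    congr 1
    funext i
    simp [window]
  | succ h ih =>
    have := ih (n + 1) (by omega) fun z τ => F (pushMem z (τ 0).2.1 (τ 0).2.2) (Fin.tail τ)
    simp only [occupancy, expect_bind, expect_map]
    refine Eq.trans ?_ (this.trans ?_)
    · refine expect_congr _ fun τ => ?_
      rw [memAt_succ]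
      congr 1
      funext i
      simp only [window, Fin.tail, Fin.val_succ]
      congr 2
      omega
    · refine expect_congr _ fun x => ?_
      rw [expect_rollout_succ]
      simp only [Fin.cons_zero, Fin.tail_cons]

variable [Nonempty A]

/-- Expected value of a function of the `K`-step future from the latent state `s`. -/
noncomputable def futMean (f : Fut O A K → ℝ) (s : S) : ℝ := ∑ t, P.obsMatrix K t s * f t

omit [Fintype S] in
theorem sum_obsMatrix (s : S) : ∑ t, P.obsMatrix K t s = 1 := sum_toReal_eq_one _

omit [Fintype S] in
theorem abs_futMean_le {f : Fut O A K → ℝ} {B : ℝ} (hf : ∀ t, |f t| ≤ B) (s : S) :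
    |P.futMean f s| ≤ B := abs_expect_le (PMF.map _ _) hf

omit [Fintype S] in
theorem futMean_zero (s : S) : P.futMean (0 : Fut O A K → ℝ) s = 0 := by simp [futMean]

theorem expect_rollout_futAt (π : Policy O A M) (n h : ℕ) (hn : K ≤ n)
    (hπ : ∀ j, h ≤ j → π j = unifPolicy O A M j) (z : Mem O A M h) (s : S) (f : Fut O A K → ℝ) :
    (expect (P.rollout π n h z s) fun τ => f (futAt K (obs τ) 0 (by omega))) = P.futMean f s := by
  have h1 : (expect (P.rollout π n h z s) fun τ => f (futAt K (obs τ) 0 (by omega))) =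
      expect (P.rollout π K h z s) fun τ => f (futAt K (obs τ) 0 (by omega)) := by
    rw [← P.rollout_take π hn h z s, expect_map]
    rfl
  rw [h1, P.rollout_congr K h z s fun j hj _ => hπ j hj,
    P.rollout_unifPolicy (M' := 0) K h 0 z emptyMem s, futMean,
    ← expect_map _ (fun τ => futAt K (obs τ) 0 (by omega)) f]
  rfl

theorem expect_traj_futAt (π : Policy O A M) {H : ℕ} (h : ℕ) (hh : h ≤ H)
    (g : Mem O A M h → Fut O A K → ℝ) :
    (expect (P.traj (thenUnif π h) (H + K)) fun τ =>
      g (memAt M (obs τ) h (by omega)) (futAt K (obs τ) h (by omega))) =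
    expect (P.occupancy π h) fun x => P.futMean (g x.1) x.2 := by
  have h1 := P.expect_traj_window (thenUnif π h) (N := H + K) h (H + K - h) (by omega)
    fun z τ => g z (futAt K (obs τ) 0 (by omega))
  have hocc : P.occupancy (thenUnif π h) h = P.occupancy π h :=
    P.occupancy_congr h fun j hj => by simp [thenUnif, hj]
  refine Eq.trans (expect_congr _ fun τ => ?_) (h1.trans ?_)
  · refine congrArg _ (futAt_congr _ _ _ _ _ _ fun i hi => ?_)
    simp [obs, window]
  rw [hocc]
  refine expect_congr _ fun x => P.expect_rollout_futAt _ _ _ (by omega) (fun j hj => ?_) _ _ _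
  simp [thenUnif, not_lt.2 hj]

/-- The law `ρ h` at step `h` is left free: it is the evaluated policy in the Bellman error and
uniform in the importance-weighted loss. -/
theorem expect_traj_step (ρ π : Policy O A M) {H : ℕ} (h : ℕ) (hh : h < H)
    (hlt : ∀ j < h, ρ j = π j) (hgt : ∀ j, h < j → ρ j = unifPolicy O A M j)
    (Ψ : Mem O A M h → S × O × A → Fut O A K → ℝ) :
    (expect (P.traj ρ (H + K)) fun τ => Ψ (memAt M (obs τ) h (by omega)) (τ ⟨h, by omega⟩)
      (futAt K (obs τ) (h + 1) (by omega))) =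
    expect (P.occupancy π h) fun x => expect (P.emit x.2) fun o => expect (ρ h x.1 o) fun a =>
      expect (P.trans x.2 a) fun s' => P.futMean (Ψ x.1 (x.2, o, a)) s' := by
  have h1 := P.expect_traj_window ρ (N := H + K) h (H + K - h - 1 + 1) (by omega)
    fun z τ => Ψ z (τ 0) (futAt K (obs (Fin.tail τ)) 0 (by omega))
  refine Eq.trans (expect_congr _ fun τ => ?_) (h1.trans ?_)
  · refine congrArg _ (futAt_congr _ _ _ _ _ _ fun i hi => ?_)
    simp only [obs, window, Fin.tail, Fin.succ_mk]
    congr 3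
    omega
  · rw [P.occupancy_congr h hlt]
    refine expect_congr _ fun x => ?_
    rw [expect_rollout_succ]
    refine expect_congr _ fun o => expect_congr _ fun a => expect_congr _ fun s' => ?_
    simp only [Fin.cons_zero, Fin.tail_cons]
    exact P.expect_rollout_futAt _ _ _ (by omega) (fun j hj => hgt j (by omega)) _ _ _

end POMDP

/-! ### Residuals, value links and the PO-bilinear structure. -/

theorem sum_abs_le_oneNorm {m n : Type*} [Fintype m] [Fintype n] (B : Matrix m n ℝ) (j : n) :
    ∑ i, |B i j| ≤ oneNorm B :=
  le_ciSup (f := fun j => ∑ i, |B i j|) (Set.finite_range _).bddAbove j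

/-- Vectors with finitely many coordinates embed isometrically in every Euclidean space whose
dimension is large enough. -/
theorem exists_euclidean_embedding (ι : Type*) [Fintype ι] (d : ℕ) (hd : Fintype.card ι ≤ d) :
    ∃ Φ : (ι → ℝ) → EuclideanSpace ℝ (Fin d), ∀ f g, inner ℝ (Φ f) (Φ g) = ∑ x, f x * g x := by
  classical
  obtain ⟨e⟩ := Function.Embedding.nonempty_of_card_le (α := ι) (β := Fin d) (by simpa using hd)
  refine ⟨fun f => WithLp.toLp 2 (Function.extend e f 0), fun f g => ?_⟩
  rw [PiLp.inner_apply]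
  simp only [RCLike.inner_apply, conj_trivial]
  rw [← sum_subset (subset_univ (univ.map e)), sum_map]
  · refine sum_congr rfl fun x _ => ?_
    rw [e.injective.extend_apply, e.injective.extend_apply, mul_comm]
  · intro i _ hi
    have : ¬∃ a, e a = i := by simpa using hi
    rw [Function.extend_apply' _ _ _ this, Pi.zero_apply, zero_mul]

theorem card_mem_prod_le (S O A : Type*) [Fintype S] [Fintype O] [Nonempty O] [Fintype A]
    [Nonempty A] (M h : ℕ) : Fintype.card (Mem O A M h × S) ≤
      Fintype.card S * Fintype.card O ^ M * Fintype.card A ^ M := by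
  classical
  rw [Fintype.card_prod, Fintype.card_fun, Fintype.card_prod, Fintype.card_fin, mul_comm,
    mul_assoc, ← mul_pow]
  exact Nat.mul_le_mul_left _ (Nat.pow_le_pow_right (Nat.mul_pos Fintype.card_pos
    Fintype.card_pos) (min_le_right _ _))

namespace POMDP

variable {S O A : Type*} [Fintype S] [Fintype O] [Fintype A] (P : POMDP S O A) {M K : ℕ}

/-- Expected total reward of `n` steps from step `h` on. -/
noncomputable def value (π : Policy O A M) (n h : ℕ) (z : Mem O A M h) (s : S) : ℝ :=
  expect (P.rollout π n h z s) fun τ => ∑ i, P.rew h τ i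

theorem value_zero (π : Policy O A M) (h : ℕ) (z : Mem O A M h) (s : S) :
    P.value π 0 h z s = 0 := by
  simp [value, expect_def]

theorem value_succ (π : Policy O A M) (n h : ℕ) (z : Mem O A M h) (s : S) :
    P.value π (n + 1) h z s = expect (P.emit s) fun o => expect (π h z o) fun a =>
      P.reward h s o a + expect (P.trans s a) fun s' => P.value π n (h + 1) (pushMem z o a) s' := by
  rw [value, expect_rollout_succ]
  refine expect_congr _ fun o => expect_congr _ fun a => ?_
  rw [← expect_const (P.trans s a) (P.reward h s o a), ← expect_add]
  refine expect_congr _ fun s' => ?_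
  rw [value, ← expect_const (P.rollout π n (h + 1) (pushMem z o a) s') (P.reward h s o a),
    ← expect_add]
  refine expect_congr _ fun τ => ?_
  rw [Fin.sum_univ_succ]
  congr 1
  refine sum_congr rfl fun i _ => ?_
  simp only [rew, Fin.cons_succ, Fin.val_succ]
  congr 1
  omega

theorem value_mem_Icc (π : Policy O A M) {H : ℕ}
    (hr : ∀ h < H, ∀ s o a, 0 ≤ P.reward h s o a ∧ P.reward h s o a ≤ 1) (n h : ℕ)
    (hn : h + n ≤ H) (z : Mem O A M h) (s : S) :
    0 ≤ P.value π n h z s ∧ P.value π n h z s ≤ n := by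
  have h1 : ∀ (τ : Fin n → S × O × A) (i : Fin n), 0 ≤ P.rew h τ i ∧ P.rew h τ i ≤ 1 :=
    fun τ i => hr _ (by have := i.isLt; omega) _ _ _
  constructor
  · exact expect_nonneg _ fun τ => sum_nonneg fun i _ => (h1 τ i).1
  · rw [value, ← expect_const (P.rollout π n h z s) (n : ℝ)]
    refine expect_mono _ fun τ => (sum_le_sum fun i _ => (h1 τ i).2).trans ?_
    simp

theorem J_eq (H : ℕ) (π : Policy O A M) :
    P.J H π = expect P.init fun s => P.value π H 0 emptyMem s := by
  rw [J, expect_traj]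
  rfl

variable [Nonempty A]

theorem isValueLink_iff (H : ℕ) (π : Policy O A M) (g : Link O A M K) :
    P.IsValueLink H π g ↔
      ∀ h < H, ∀ z s, P.futMean (g h z) s = P.value π (H - h) h z s := by
  refine forall₂_congr fun h _ => forall₂_congr fun z s => ?_
  rw [P.expect_rollout_futAt _ _ _ le_rfl (fun _ _ => rfl) z s (g h z)]
  rfl

/-- The Bellman residual given the memory and the latent state. -/
noncomputable def residual (π : Policy O A M) (g : Link O A M K) (h : ℕ) (z : Mem O A M h)
    (s : S) : ℝ :=
  P.futMean (g h z) s - expect (P.emit s) fun o => expect (π h z o) fun a =>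
    P.reward h s o a + expect (P.trans s a) fun s' => P.futMean (g (h + 1) (pushMem z o a)) s'

omit [Fintype S] in
theorem futMean_const_add (c : ℝ) (f : Fut O A K → ℝ) (s : S) :
    P.futMean (fun t => c + f t) s = c + P.futMean f s := by
  simp only [futMean, mul_add, sum_add_distrib, ← sum_mul, sum_obsMatrix, one_mul]

omit [Fintype S] in
theorem futMean_mul_left (c : ℝ) (f : Fut O A K → ℝ) (s : S) :
    P.futMean (fun t => c * f t) s = c * P.futMean f s := by
  simp only [futMean, mul_sum, mul_left_comm]

theorem bellmanError_eq {H : ℕ} (π : Policy O A M) (g : Link O A M K) (π' : Policy O A M)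
    (h : Fin H) :
    P.bellmanError π g π' h =
      expect (P.occupancy π' h) fun x => P.residual π g h x.1 x.2 := by
  rw [bellmanError, P.expect_traj_futAt π' h h.isLt.le (g h)]
  simp only [residual]
  rw [expect_sub]
  congr 1
  have h1 := P.expect_traj_step (K := K) (thenOneThenUnif π' h π) π' h h.isLt
    (fun j hj => by simp [thenOneThenUnif, hj])
    (fun j hj => by simp [thenOneThenUnif, hj.ne', not_lt.2 hj.le])
    fun z y t => P.reward h y.1 y.2.1 y.2.2 + g (h + 1) (pushMem z y.2.1 y.2.2) t
  refine Eq.trans (expect_congr _ fun τ => ?_) (h1.trans ?_)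
  · rw [memAt_succ]
    simp [rew, obs]
  · refine expect_congr _ fun x => expect_congr _ fun o => ?_
    simp only [futMean_const_add, expect_add, expect_const, thenOneThenUnif, lt_irrefl, if_false,
      if_true]

/-- Importance weighting: the expected loss under uniform actions is the negated Bellman error. -/
theorem expect_tdLoss {H : ℕ} (π : Policy O A M) (g : Link O A M K) (π' : Policy O A M)
    (h : Fin H) :
    (expect (P.traj (thenUnif π' h) (H + K)) fun τ => tdLoss π g h (obs τ, P.rew 0 τ)) =
      -P.bellmanError π g π' h := by
  simp only [tdLoss]
  rw [expect_sub, P.expect_traj_futAt π' h h.isLt.le (g h), bellmanError_eq]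
  simp only [residual]
  rw [expect_sub, neg_sub]
  congr 1
  have h1 := P.expect_traj_step (K := K) (thenUnif π' h) π' h h.isLt
    (fun j hj => by simp [thenUnif, hj])
    (fun j hj => by simp [thenUnif, not_lt.2 hj.le])
    fun z y t => (Fintype.card A : ℝ) * (π h z y.2.1 y.2.2).toReal *
      (P.reward h y.1 y.2.1 y.2.2 + g (h + 1) (pushMem z y.2.1 y.2.2) t)
  refine Eq.trans (expect_congr _ fun τ => ?_) (h1.trans ?_)
  · rw [memAt_succ]
    simp [rew, obs]
  · refine expect_congr _ fun x => expect_congr _ fun o => ?_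
    simp only [futMean_mul_left, futMean_const_add, expect_mul_left,
      thenUnif, lt_irrefl, if_false, unifPolicy, expect_uniformOfFintype]
    rw [mul_sum, expect_def]
    refine sum_congr rfl fun a _ => ?_
    rw [expect_add, expect_const]
    have : (Fintype.card A : ℝ) ≠ 0 := by exact_mod_cast Fintype.card_ne_zero
    field_simp

theorem residual_eq_zero {H : ℕ} {π : Policy O A M} {g : Link O A M K} (h0 : ∀ h ≥ H, g h = 0)
    (hg : P.IsValueLink H π g) (h : Fin H) (z : Mem O A M h) (s : S) :
    P.residual π g h z s = 0 := by
  rw [isValueLink_iff] at hg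
  -- At `h + 1 = H` the link identity is not available; both sides vanish there, as `g H = 0` and no
  -- reward remains. The residual is then the Bellman equation `value_succ`.
  have h1 : ∀ z s, P.futMean (g (h + 1) z) s = P.value π (H - (h + 1)) (h + 1) z s := by
    intro z s
    rcases lt_or_ge ((h : ℕ) + 1) H with h' | h'
    · exact hg _ h' z s
    · rw [h0 _ h', Nat.sub_eq_zero_of_le h', value_zero, Pi.zero_apply, futMean_zero]
  have h2 : H - (h : ℕ) = H - (h + 1) + 1 := by have := h.isLt; omega
  rw [residual, hg h h.isLt z s, h2, value_succ]
  simp only [h1, sub_self]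

theorem abs_residual_le {H : ℕ} (hr : ∀ h < H, ∀ s o a, 0 ≤ P.reward h s o a ∧
    P.reward h s o a ≤ 1) (π : Policy O A M) {g : Link O A M K} {B : ℝ}
    (hg : ∀ h z t, |g h z t| ≤ B) (h : Fin H) (z : Mem O A M h) (s : S) :
    |P.residual π g h z s| ≤ 1 + 2 * B := by
  refine (abs_sub _ _).trans ?_
  have h1 : |P.futMean (g h z) s| ≤ B := P.abs_futMean_le (hg h z) s
  have h2 : |expect (P.emit s) fun o => expect (π h z o) fun a =>
      P.reward h s o a + expect (P.trans s a) fun s' =>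
        P.futMean (g (h + 1) (pushMem z o a)) s'| ≤ 1 + B := by
    refine abs_expect_le _ fun o => abs_expect_le _ fun a => (abs_add_le _ _).trans (add_le_add ?_
      (abs_expect_le _ fun s' => P.abs_futMean_le (hg _ _) s'))
    rw [abs_of_nonneg (hr h h.isLt s o a).1]
    exact (hr h h.isLt s o a).2
  linarith

/-- The full-rank condition: expectations over futures are inverted by the Moore--Penrose
inverse. -/
theorem futMean_pinv [DecidableEq S] (hP : (P.obsMatrix K).rank = Fintype.card S) (θ : S → ℝ)
    (s : S) : P.futMean (fun t => ∑ s', θ s' * pinv (P.obsMatrix K) s' t) s = θ s := by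
  have h1 := (pinv_spec _ hP).1
  calc P.futMean (fun t => ∑ s', θ s' * pinv (P.obsMatrix K) s' t) s
      = ∑ s', θ s' * (pinv (P.obsMatrix K) * P.obsMatrix K) s' s := by
        simp only [futMean, mul_sum, Matrix.mul_apply]
        rw [sum_comm]
        exact sum_congr rfl fun s' _ => sum_congr rfl fun t _ => by ring
    _ = θ s := by simp [h1, Matrix.one_apply]

/-- With `θ` the indicator of one state, `1` is the mean, under a law on futures, of a row of the
inverse, whose entries are at most `b` in absolute value. It plays the role of `σ ≤ 1` in the
structural half. -/
theorem one_le_inv_of_oneNorm_pinv_le [DecidableEq S]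
    (hP : (P.obsMatrix K).rank = Fintype.card S) {b : ℝ}
    (hb : oneNorm (pinv (P.obsMatrix K)) ≤ b) : 1 ≤ b := by
  classical
  obtain ⟨s, -⟩ := P.init.support_nonempty
  have h1 := P.futMean_pinv hP (Pi.single s 1) s
  simp only [Pi.single_apply, ite_mul, one_mul, zero_mul, sum_ite_eq', mem_univ, if_true] at h1
  refine (le_abs_self 1).trans ?_
  rw [← h1]
  refine P.abs_futMean_le (fun t => ?_) s
  exact ((single_le_sum (f := fun i => |pinv (P.obsMatrix K) i t|) (fun i _ => abs_nonneg _)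
    (mem_univ s)).trans (sum_abs_le_oneNorm _ t)).trans hb

theorem linkClass_subset [DecidableEq S] (H : ℕ) {σ : ℝ}
    (hσ : oneNorm (pinv (P.obsMatrix K)) ≤ 1 / σ) :
    P.linkClass H M K ⊆ boundedLinks O A H M K (H / σ) := by
  rintro g ⟨hg, h0⟩
  refine ⟨fun h hh z t => ?_, h0⟩
  obtain ⟨θ, hθ, h1⟩ := hg h hh
  rw [h1]
  calc |∑ s, θ z s * pinv (P.obsMatrix K) s t| ≤ ∑ s, H * |pinv (P.obsMatrix K) s t| := by
        refine (abs_sum_le_sum_abs _ _).trans (sum_le_sum fun s _ => ?_)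
        rw [abs_mul]
        exact mul_le_mul_of_nonneg_right (hθ z s) (abs_nonneg _)
    _ ≤ H * (1 / σ) := by
        rw [← mul_sum]
        exact mul_le_mul_of_nonneg_left ((sum_abs_le_oneNorm _ t).trans hσ) (Nat.cast_nonneg _)
    _ = H / σ := by ring

/-- The weights `θ` are the values themselves, which lie in `[0, H]`. -/
theorem exists_isValueLink_linkClass [DecidableEq S] {H : ℕ}
    (hr : ∀ h < H, ∀ s o a, 0 ≤ P.reward h s o a ∧ P.reward h s o a ≤ 1)
    (hP : (P.obsMatrix K).rank = Fintype.card S) (π : Policy O A M) :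
    ∃ g ∈ P.linkClass H M K, P.IsValueLink H π g := by
  refine ⟨fun h z t => if h < H then ∑ s, P.value π (H - h) h z s * pinv (P.obsMatrix K) s t else 0,
    ⟨fun h hh => ⟨P.value π (H - h) h, fun z s => ?_, fun z t => if_pos hh⟩, fun h hh => ?_⟩, ?_⟩
  · obtain ⟨h1, h2⟩ := P.value_mem_Icc π hr (H - h) h (by omega) z s
    rw [abs_of_nonneg h1]
    exact h2.trans (by exact_mod_cast Nat.sub_le _ _)
  · funext z t
    exact if_neg (not_lt.2 hh)
  · rw [isValueLink_iff]
    intro h hh z s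
    simp only [hh, if_true]
    exact P.futMean_pinv hP (P.value π (H - h) h z) s

theorem exists_isValueLink [DecidableEq S] {H : ℕ} {σ : ℝ}
    (hr : ∀ h < H, ∀ s o a, 0 ≤ P.reward h s o a ∧ P.reward h s o a ≤ 1)
    (hP : (P.obsMatrix K).rank = Fintype.card S) (hσ : oneNorm (pinv (P.obsMatrix K)) ≤ 1 / σ)
    {G : Set (Link O A M K)} (hG : G = P.linkClass H M K ∨ G = boundedLinks O A H M K (H / σ))
    (π : Policy O A M) : ∃ g ∈ G, P.IsValueLink H π g := by
  obtain ⟨g, hg, h⟩ := P.exists_isValueLink_linkClass hr hP π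
  rcases hG with rfl | rfl
  · exact ⟨g, hg, h⟩
  · exact ⟨g, P.linkClass_subset H hσ hg, h⟩

theorem isPOBilinear_of_subset {H : ℕ} {B : ℝ}
    (hr : ∀ h < H, ∀ s o a, 0 ≤ P.reward h s o a ∧ P.reward h s o a ≤ 1) (hB : 1 ≤ B)
    {G : Set (Link O A M K)} (hG : G ⊆ boundedLinks O A H M K B)
    (hv : ∀ π : Policy O A M, ∃ g ∈ G, P.IsValueLink H π g) (d : ℕ)
    (hd : Fintype.card S * Fintype.card O ^ M * Fintype.card A ^ M ≤ d) :
    P.IsPOBilinear H G d 1 (4 * B * √d) := by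
  have hO : Nonempty O :=
    let ⟨s, _⟩ := P.init.support_nonempty
    let ⟨o, _⟩ := (P.emit s).support_nonempty
    ⟨o⟩
  have hcard : ∀ h, Fintype.card (Mem O A M h × S) ≤ d := fun h =>
    (card_mem_prod_le S O A M h).trans hd
  choose Φ hΦ using fun h => exists_euclidean_embedding (Mem O A M h × S) d (hcard h)
  have hb : ∀ g ∈ G, ∀ h z t, |g h z t| ≤ B := by
    intro g hg h z t
    rcases lt_or_ge h H with h' | h'
    · exact (hG hg).1 h h' z t
    · rw [(hG hg).2 h h']
      simpa using zero_le_one.trans hB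
  -- Coordinates are pairs (memory, state), with residuals in `W` and occupancy probabilities in
  -- `X`. Thus `‖X‖² = ∑ p² ≤ ∑ p = 1`, and `|residual| ≤ 1 + 2 B ≤ 4 B` bounds `W`.
  refine ⟨hv, fun h π g => Φ h fun x => P.residual π g h x.1 x.2,
    fun h π' => Φ h fun x => (P.occupancy π' h x).toReal, ?_, ?_, ?_, ?_⟩
  · intro h π g _ π'
    rw [hΦ, bellmanError_eq, expect_def]
    exact sum_congr rfl fun x _ => mul_comm _ _
  · intro h π g hg hgπ
    rw [← inner_self_eq_zero (𝕜 := ℝ), hΦ]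
    refine sum_eq_zero fun x _ => ?_
    rw [P.residual_eq_zero (hG hg).2 hgπ h, mul_zero]
  · intro h π
    rw [← sq_le_one_iff₀ (norm_nonneg _), ← real_inner_self_eq_norm_sq, hΦ,
      ← sum_toReal_eq_one (P.occupancy π h)]
    exact sum_le_sum fun x _ => mul_le_of_le_one_left ENNReal.toReal_nonneg
      (ENNReal.toReal_le_of_le_ofReal zero_le_one (by simpa using PMF.coe_le_one _ x))
  · intro h π g hg
    refine le_of_sq_le_sq ?_ (by positivity)
    rw [← real_inner_self_eq_norm_sq, hΦ, mul_pow, Real.sq_sqrt (Nat.cast_nonneg _)]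
    calc ∑ x : Mem O A M h × S, P.residual π g h x.1 x.2 * P.residual π g h x.1 x.2
        ≤ ∑ x : Mem O A M h × S, (4 * B) ^ 2 := by
          refine sum_le_sum fun x _ => ?_
          have := P.abs_residual_le hr π (hb g hg) h x.1 x.2
          rw [← sq]
          exact sq_le_sq' (by linarith [(abs_le.1 this).1]) (by linarith [(abs_le.1 this).2])
      _ ≤ (4 * B) ^ 2 * d := by
          rw [sum_const, card_univ, nsmul_eq_mul, mul_comm]
          exact mul_le_mul_of_nonneg_left (by exact_mod_cast hcard h) (sq_nonneg _)

end POMDP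

/-! ### Elliptical potential. -/

section EllipticalPotential

open Matrix

variable {ι : Type*} [Fintype ι] [DecidableEq ι]

/-- Cauchy–Schwarz for the form of `B`: with `y = B⁻¹ x`, the quadratic `r ↦ ⟨r w - y, B (r w - y)⟩`
is nonnegative, so its discriminant is not positive. -/
theorem dotProduct_sq_le_of_posDef {B : Matrix ι ι ℝ} (hB : B.PosDef) (w x : ι → ℝ) :
    (w ⬝ᵥ x) ^ 2 ≤ (w ⬝ᵥ B *ᵥ w) * (x ⬝ᵥ B⁻¹ *ᵥ x) := by
  have hu : IsUnit B.det := (isUnit_iff_isUnit_det _).1 hB.isUnit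
  have hBs : Bᵀ = B := by simpa using hB.isHermitian.eq
  set y := B⁻¹ *ᵥ x with hy
  have hBy : B *ᵥ y = x := by rw [hy, mulVec_mulVec, mul_nonsing_inv _ hu, one_mulVec]
  have hyw : y ⬝ᵥ B *ᵥ w = w ⬝ᵥ x := by
    rw [dotProduct_mulVec, ← mulVec_transpose, hBs, hBy, dotProduct_comm]
  have h := discrim_le_zero (a := w ⬝ᵥ B *ᵥ w) (b := -2 * (w ⬝ᵥ x)) (c := x ⬝ᵥ y) fun r => by
    have h0 := hB.posSemidef.dotProduct_mulVec_nonneg (r • w - y)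
    simp only [star_trivial, mulVec_sub, mulVec_smul, dotProduct_sub, sub_dotProduct, hBy,
      dotProduct_smul, smul_dotProduct, hyw, smul_eq_mul] at h0
    rw [dotProduct_comm y x] at h0
    linarith
  rw [discrim] at h
  linarith

theorem det_add_vecMulVec_self {B : Matrix ι ι ℝ} (hB : B.PosDef) (x : ι → ℝ) :
    (B + vecMulVec x x).det = B.det * (1 + x ⬝ᵥ B⁻¹ *ᵥ x) := by
  have hu : IsUnit B.det := (isUnit_iff_isUnit_det _).1 hB.isUnit
  rw [vecMulVec_eq Unit, det_add_replicateCol_mul_replicateRow hu]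
  congr 1
  rw [det_unique, Matrix.mul_assoc, ← replicateCol_mulVec]
  simp

/-- Eigenvalues are positive, so each is at most their sum. This is cruder than AM-GM, but the loss
stays inside a logarithm. -/
theorem det_le_trace_pow {B : Matrix ι ι ℝ} (hB : B.PosDef) :
    B.det ≤ B.trace ^ Fintype.card ι := by
  rw [hB.isHermitian.det_eq_prod_eigenvalues, hB.isHermitian.trace_eq_sum_eigenvalues,
    ← card_univ, ← prod_const]
  exact prod_le_prod (fun i _ => (hB.eigenvalues_pos i).le) fun i _ =>
    single_le_sum (f := fun i => hB.isHermitian.eigenvalues i)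
      (fun j _ => (hB.eigenvalues_pos j).le) (mem_univ i)

/-- Regularized Gram matrix of the first `t` vectors of a sequence. -/
def gram (l : ℝ) (X : ℕ → ι → ℝ) : ℕ → Matrix ι ι ℝ
  | 0 => l • 1
  | t + 1 => gram l X t + vecMulVec (X t) (X t)

theorem gram_posDef {l : ℝ} (hl : 0 < l) (X : ℕ → ι → ℝ) (t : ℕ) : (gram l X t).PosDef := by
  induction t with
  | zero => exact PosDef.one.smul hl
  | succ t ih => exact ih.add_posSemidef (by simpa using posSemidef_vecMulVec_self_star (X t))

theorem dotProduct_gram_mulVec (l : ℝ) (X : ℕ → ι → ℝ) (t : ℕ) (w : ι → ℝ) :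
    w ⬝ᵥ gram l X t *ᵥ w = l * (w ⬝ᵥ w) + ∑ i ∈ range t, (w ⬝ᵥ X i) ^ 2 := by
  induction t with
  | zero => simp [gram, smul_mulVec]
  | succ t ih =>
    rw [gram, add_mulVec, dotProduct_add, ih, sum_range_succ, vecMulVec_mulVec, add_assoc]
    simp only [dotProduct_smul, MulOpposite.smul_eq_mul_unop, MulOpposite.unop_op]
    rw [dotProduct_comm (X t) w, sq]

theorem trace_gram_le {l : ℝ} {X : ℕ → ι → ℝ} (hX : ∀ t, X t ⬝ᵥ X t ≤ 1) (t : ℕ) :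
    (gram l X t).trace ≤ Fintype.card ι * l + t := by
  induction t with
  | zero => simp [gram, mul_comm]
  | succ t ih =>
    rw [gram, trace_add, trace_vecMulVec]
    push_cast
    linarith [hX t]

/-- The elliptical potential lemma. -/
theorem exists_elliptical_potential {l : ℝ} (hl : 0 < l) {X : ℕ → ι → ℝ}
    (hX : ∀ t, X t ⬝ᵥ X t ≤ 1) :
    ∃ Y : ℕ → ℝ, (∀ t, 0 ≤ Y t) ∧
      (∀ T : ℕ, ∑ t ∈ range T, Y t ≤
        Fintype.card ι * Real.log (Fintype.card ι + T / l)) ∧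
      ∀ (t : ℕ) (w : ι → ℝ), (w ⬝ᵥ X t) ^ 2 ≤
        (l * (w ⬝ᵥ w) + ∑ i ∈ range t, (w ⬝ᵥ X i) ^ 2) * (Real.exp (Y t) - 1) := by
  have hpd := gram_posDef hl X
  have hx : ∀ t, 0 ≤ X t ⬝ᵥ (gram l X t)⁻¹ *ᵥ X t := fun t => by
    simpa using (hpd t).inv.posSemidef.dotProduct_mulVec_nonneg (X t)
  -- `Y t` is the growth of the log-determinant of the Gram matrix, so its sum telescopes, and `exp
  -- (Y t) - 1` is the squared norm of `X t` for the inverse Gram matrix.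
  refine ⟨fun t => Real.log (1 + X t ⬝ᵥ (gram l X t)⁻¹ *ᵥ X t),
    fun t => Real.log_nonneg (by linarith [hx t]), fun T => ?_, fun t w => ?_⟩
  · have hstep : ∀ t, Real.log (1 + X t ⬝ᵥ (gram l X t)⁻¹ *ᵥ X t) =
        Real.log (gram l X (t + 1)).det - Real.log (gram l X t).det := fun t => by
      rw [gram, det_add_vecMulVec_self (hpd t), Real.log_mul (hpd t).det_pos.ne'
        (by linarith [hx t]), add_sub_cancel_left]
    simp only [hstep]
    rw [sum_range_sub fun t => Real.log (gram l X t).det]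
    rcases Nat.eq_zero_or_pos (Fintype.card ι) with h0 | h0
    · have : IsEmpty ι := Fintype.card_eq_zero_iff.1 h0
      simp
    have hd : (0 : ℝ) < Fintype.card ι := by exact_mod_cast h0
    have h1 : Real.log (gram l X T).det ≤
        Fintype.card ι * Real.log (Fintype.card ι * l + T) := by
      rw [← Real.log_pow]
      exact Real.log_le_log (hpd T).det_pos ((det_le_trace_pow (hpd T)).trans
        (pow_le_pow_left₀ (hpd T).posSemidef.trace_nonneg (trace_gram_le hX T) _))
    have h2 : Real.log (gram l X 0).det = Fintype.card ι * Real.log l := by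
      simp [gram]
    have h3 : (Fintype.card ι : ℝ) + T / l = (Fintype.card ι * l + T) / l := by field_simp
    rw [h3, Real.log_div (by positivity) hl.ne', h2]
    linarith
  · rw [Real.exp_log (by linarith [hx t]), add_sub_cancel_left, ← dotProduct_gram_mulVec]
    exact dotProduct_sq_le_of_posDef (hpd t) w (X t)

end EllipticalPotential

/-! ### Compactness of the link classes. -/

section Compactness

variable {O A : Type*} {M K : ℕ}

/-- Links are indexed by all of `ℕ`, so this is Tychonoff's theorem; beyond the horizon each factor
is `{0}`. -/
theorem isCompact_boundedLinks (H : ℕ) (B : ℝ) : IsCompact (boundedLinks O A H M K B) := by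
  have : boundedLinks O A H M K B = Set.pi Set.univ fun h => Set.pi Set.univ fun _ =>
      Set.pi Set.univ fun _ => if h < H then Set.Icc (-B) B else {0} := by
    ext g
    simp only [boundedLinks, Set.mem_ofPred_eq, Set.mem_univ_pi]
    constructor
    · rintro ⟨h1, h2⟩ h z t
      split_ifs with hh
      · exact abs_le.1 (h1 h hh z t)
      · exact congrFun (congrFun (h2 h (not_lt.1 hh)) z) t
    · intro hg
      constructor
      · intro h hh z t
        have := hg h z t
        rw [if_pos hh] at this
        exact abs_le.2 this
      · intro h hh
        funext z t
        have := hg h z t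
        rw [if_neg (not_lt.2 hh)] at this
        exact this
  rw [this]
  refine isCompact_univ_pi fun h => isCompact_univ_pi fun z => isCompact_univ_pi fun t => ?_
  split_ifs
  · exact isCompact_Icc
  · exact isCompact_singleton

/-- The class is the continuous image of a compact box of parameters `θ`, extended by zero beyond
the horizon. -/
theorem POMDP.isCompact_linkClass {S : Type*} [Fintype S] [DecidableEq S] [Fintype O] [Fintype A]
    [Nonempty A] (P : POMDP S O A) (H : ℕ) : IsCompact (P.linkClass H M K) := by
  set Θ : Set ((h : ℕ) → Mem O A M h → S → ℝ) := Set.pi Set.univ fun h => Set.pi Set.univ fun _ =>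
      Set.pi Set.univ fun _ => if h < H then Set.Icc (-(H : ℝ)) H else {0} with hΘ
  have hc : IsCompact Θ := by
    refine isCompact_univ_pi fun h => isCompact_univ_pi fun z => isCompact_univ_pi fun t => ?_
    split_ifs
    · exact isCompact_Icc
    · exact isCompact_singleton
  have : P.linkClass H M K = (fun (θ : (h : ℕ) → Mem O A M h → S → ℝ) h z t =>
      ∑ s, θ h z s * pinv (P.obsMatrix K) s t) '' Θ := by
    ext g
    constructor
    · rintro ⟨h1, h2⟩
      choose! θ hθ hg using h1
      refine ⟨fun h z s => if h < H then θ h z s else 0, ?_, ?_⟩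
      · simp only [hΘ, Set.mem_univ_pi]
        intro h z s
        split_ifs with hh
        · exact abs_le.1 (hθ h hh z s)
        · rfl
      · funext h z t
        by_cases hh : h < H
        · simp only [hh, if_true, hg h hh]
        · simp [hh, h2 h (not_lt.1 hh)]
    · rintro ⟨θ, hθ, rfl⟩
      simp only [hΘ, Set.mem_univ_pi] at hθ
      constructor
      · refine fun h hh => ⟨θ h, fun z s => ?_, fun z t => rfl⟩
        have := hθ h z s
        rw [if_pos hh] at this
        exact abs_le.2 this
      · intro h hh
        funext z t
        refine sum_eq_zero fun s _ => ?_
        have := hθ h z s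
        rw [if_neg (not_lt.2 hh)] at this
        rw [this, zero_mul]
  rw [this]
  exact hc.image (by fun_prop)

end Compactness

/-! ### Existence of optimistic choices. -/

section Selection

variable {O A : Type*} [Fintype A] {H M K m : ℕ}

/-- The temporal-difference loss as a function of the entries of the policy and of two successive
link functions. -/
noncomputable def tdForm (h : Fin H) (u : Mem O A M h → O → A → ℝ)
    (v : Mem O A M (h + 1) → Fut O A K → ℝ) (w : Mem O A M h → Fut O A K → ℝ)
    (e : Episode O A (H + K)) : ℝ :=
  (Fintype.card A : ℝ) *
      u (memAt M e.1 h (by omega)) (e.1 ⟨h, by omega⟩).1 (e.1 ⟨h, by omega⟩).2 *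
      (e.2 ⟨h, by omega⟩ +
        v (memAt M e.1 (h + 1) (by omega)) (futAt K e.1 (h + 1) (by omega)))
    - w (memAt M e.1 h (by omega)) (futAt K e.1 h (by omega))

theorem tdLoss_eq_tdForm (π : Policy O A M) (g : Link O A M K) (h : Fin H)
    (e : Episode O A (H + K)) :
    tdLoss π g h e = tdForm h (fun z o a => (π h z o a).toReal) (g (h + 1)) (g h) e := rfl

theorem toReal_mem_stdSimplex (p : PMF A) : (fun a => (p a).toReal) ∈ stdSimplex ℝ A :=
  ⟨fun _ => ENNReal.toReal_nonneg, sum_toReal_eq_one p⟩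

theorem exists_pmf_of_mem_stdSimplex {x : A → ℝ} (hx : x ∈ stdSimplex ℝ A) :
    ∃ p : PMF A, ∀ a, (p a).toReal = x a := by
  refine ⟨PMF.ofFintype (fun a => ENNReal.ofReal (x a)) ?_, fun a => ?_⟩
  · rw [← ENNReal.ofReal_sum_of_nonneg fun a _ => hx.1 a, hx.2, ENNReal.ofReal_one]
  · rw [PMF.ofFintype_apply, ENNReal.toReal_ofReal (hx.1 a)]

/-- The constrained maximization has a solution when the class is compact and the constraints can
be met. -/
theorem exists_optimistic {t : ℕ} {G : Set (Link O A M K)} (hG : IsCompact G) (R : ℝ)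
    (D₀ : Batch O A (H + K) m) (D : Fin t → Round O A (H + K) H m)
    (hne : ∃ x, Feasible G R D x) : ∃ x, Optimistic G R D₀ D x := by
  -- Policies are replaced by their real entries, points of a product of simplices. On this compact
  -- set the constraints are closed and the objective is continuous.
  set F : Set (((h : ℕ) → Mem O A M h → O → A → ℝ) × Link O A M K) :=
    ((Set.pi Set.univ fun _ => Set.pi Set.univ fun _ => Set.pi Set.univ fun _ =>
      stdSimplex ℝ A) ×ˢ G) ∩
    ⋂ (i : Fin t) (h : Fin H), {y | ((∑ j, tdForm h (y.1 h) (y.2 (h + 1)) (y.2 h)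
      (D i h.castSucc j)) / m) ^ 2 ≤ R} with hF
  have hFc : IsCompact F := by
    refine IsCompact.inter_right (IsCompact.prod (isCompact_univ_pi fun _ =>
      isCompact_univ_pi fun _ => isCompact_univ_pi fun _ => isCompact_stdSimplex ℝ A) hG) ?_
    refine isClosed_iInter fun i => isClosed_iInter fun h => isClosed_le ?_ continuous_const
    simp only [tdForm]
    fun_prop
  have hmem : ∀ x : Policy O A M × Link O A M K, Feasible G R D x →
      ((fun h z o a => (x.1 h z o a).toReal), x.2) ∈ F := by
    intro x hx
    refine ⟨⟨fun h _ z _ o _ => toReal_mem_stdSimplex _, hx.1⟩, ?_⟩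
    simp only [Set.mem_iInter]
    exact fun i h => hx.2 i h
  obtain ⟨x, hx⟩ := hne
  obtain ⟨y, hyF, hy⟩ := hFc.exists_isMaxOn ⟨_, hmem x hx⟩ (f := fun y => empInit y.2 D₀) (by
    simp only [empInit]
    fun_prop)
  choose π hπ using fun h z o =>
    exists_pmf_of_mem_stdSimplex (hyF.1.1 h trivial z trivial o trivial)
  refine ⟨(π, y.2), ⟨hyF.1.2, fun i h => ?_⟩, fun x hx => hy (hmem x hx)⟩
  have := hyF.2
  simp only [Set.mem_iInter] at this
  have h1 := this i h
  simp only [empLoss, tdLoss_eq_tdForm, hπ]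
  exact h1

end Selection

/-! ### Uniform deviation bounds from the vertices of a box. -/

section Vertices

/-- As `f` is affine, `|f| ≤ η` defines a convex set, and a box is the convex hull of its vertices.
-/
theorem abs_le_of_abs_vertices_le {ι : Type*} [Finite ι] {f : (ι → ℝ) → ℝ} {a b η : ℝ}
    (hf : ∀ x y (α β : ℝ), α + β = 1 → f (α • x + β • y) = α * f x + β * f y) (hab : a ≤ b)
    (hv : ∀ c : ι → Bool, |f fun i => if c i then b else a| ≤ η) {x : ι → ℝ}
    (hx : ∀ i, x i ∈ Set.Icc a b) : |f x| ≤ η := by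
  have hconv : Convex ℝ {x | |f x| ≤ η} := by
    intro x hx y hy α β hα hβ hαβ
    rw [Set.mem_ofPred_eq, hf x y α β hαβ]
    calc |α * f x + β * f y| ≤ α * |f x| + β * |f y| := by
          refine (abs_add_le _ _).trans ?_
          rw [abs_mul, abs_mul, abs_of_nonneg hα, abs_of_nonneg hβ]
      _ ≤ α * η + β * η := add_le_add (mul_le_mul_of_nonneg_left hx hα)
          (mul_le_mul_of_nonneg_left hy hβ)
      _ = η := by rw [← add_mul, hαβ, one_mul]
  have hsub : Set.pi Set.univ (fun _ : ι => ({a, b} : Set ℝ)) ⊆ {x | |f x| ≤ η} := by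
    intro y hy
    classical
    have hy' : y = fun i => if (decide (y i = b) : Bool) then b else a := by
      funext i
      rcases hy i trivial with h | h
      · by_cases hb : y i = b
        · simp [hb]
        · simp only [hb, decide_false, Bool.false_eq_true, if_false]
          exact h
      · simp [Set.mem_singleton_iff.1 h]
    rw [Set.mem_ofPred_eq, hy']
    exact hv _
  refine convexHull_min hsub hconv ?_
  rw [convexHull_pi]
  intro i _
  rw [convexHull_pair, segment_eq_Icc hab]
  exact hx i

end Vertices

section Deviation

variable {O A : Type*} [Fintype O] [Fintype A] {H M K m : ℕ}

/-- Index set of the vertices of the box of the arguments of the temporal-difference loss. -/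
abbrev TDVertex (O A : Type*) (M K h : ℕ) :=
  (Mem O A M h × O × A → Bool) × (Mem O A M (h + 1) × Fut O A K → Bool) ×
    (Mem O A M h × Fut O A K → Bool)

/-- The temporal-difference loss at a vertex. -/
noncomputable def vertexLoss (h : Fin H) (B : ℝ) (c : TDVertex O A M K h) :
    Episode O A (H + K) → ℝ :=
  tdForm h (fun z o a => if c.1 (z, o, a) then 1 else 0)
    (fun z t => if c.2.1 (z, t) then B else -B) (fun z t => if c.2.2 (z, t) then B else -B)

omit [Fintype O] in
theorem abs_vertexLoss_le [Nonempty A] (h : Fin H) {B : ℝ} (hB : 1 ≤ B) (c : TDVertex O A M K h)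
    (e : Episode O A (H + K)) (he : |e.2 ⟨h, by omega⟩| ≤ 1) :
    |vertexLoss h B c e| ≤ 3 * Fintype.card A * B := by
  have hB' : ∀ b : Bool, |if b then B else -B| ≤ B := fun b => by
    cases b <;> simp [abs_of_nonneg (zero_le_one.trans hB)]
  have h01 : ∀ b : Bool, |if b then (1 : ℝ) else 0| ≤ 1 := fun b => by cases b <;> simp
  have hA : (1 : ℝ) ≤ Fintype.card A := by exact_mod_cast Fintype.card_pos
  rw [vertexLoss, tdForm]
  refine (abs_sub _ _).trans ?_
  rw [abs_mul, abs_mul, Nat.abs_cast]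
  have h1 := (abs_add_le (e.2 ⟨h, by omega⟩) (if c.2.1 (memAt M e.1 (h + 1) (by omega),
    futAt K e.1 (h + 1) (by omega)) then B else -B)).trans (add_le_add he (hB' _))
  have h2 := mul_le_mul (mul_le_mul_of_nonneg_left (h01 (c.1 (memAt M e.1 h (by omega),
    (e.1 ⟨h, by omega⟩).1, (e.1 ⟨h, by omega⟩).2))) (Nat.cast_nonneg (Fintype.card A))) h1
    (abs_nonneg _) (by positivity)
  have h3 := hB' (c.2.2 (memAt M e.1 h (by omega), futAt K e.1 h (by omega)))
  refine (add_le_add h2 h3).trans ?_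
  nlinarith

variable {X : Type*} [Fintype X] (p : PMF X) (φ : X → Episode O A (H + K))

/-- Empirical mean minus expectation. -/
noncomputable def deviation (D : Batch O A (H + K) m) (f : Episode O A (H + K) → ℝ) : ℝ :=
  (∑ i, f (D i)) / m - expect p fun x => f (φ x)

omit [Fintype O] [Fintype A] in
theorem deviation_affine (D : Batch O A (H + K) m) {f f₁ f₂ : Episode O A (H + K) → ℝ} {α β : ℝ}
    (hf : ∀ e, f e = α * f₁ e + β * f₂ e) :
    deviation p φ D f = α * deviation p φ D f₁ + β * deviation p φ D f₂ := by
  simp only [deviation, hf, expect_add, expect_mul_left, sum_add_distrib, ← mul_sum]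
  ring

/-- A uniform bound on the deviations at the vertices extends to the box. -/
theorem abs_deviation_le_of_vertices (h : Fin H) {B η : ℝ} (hB : 0 ≤ B)
    (D : Batch O A (H + K) m)
    (hv : ∀ c : TDVertex O A M K h, |deviation p φ D (vertexLoss h B c)| ≤ η)
    {u : Mem O A M h → O → A → ℝ} (hu : ∀ z o a, u z o a ∈ Set.Icc 0 1)
    {v : Mem O A M (h + 1) → Fut O A K → ℝ} (hv' : ∀ z t, v z t ∈ Set.Icc (-B) B)
    {w : Mem O A M h → Fut O A K → ℝ} (hw : ∀ z t, w z t ∈ Set.Icc (-B) B) :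
    |deviation p φ D (tdForm h u v w)| ≤ η := by
  have hBB : -B ≤ B := by linarith
  -- The product of `u` and `v` is not jointly affine, so vertices are exchanged for points of the
  -- box one argument at a time: `u`, then `v`, then `w`.
  have h1 : ∀ (cv : Mem O A M (h + 1) × Fut O A K → Bool) (cw : Mem O A M h × Fut O A K → Bool),
      |deviation p φ D (tdForm h u (fun z t => if cv (z, t) then B else -B)
        (fun z t => if cw (z, t) then B else -B))| ≤ η := by
    intro cv cw
    refine abs_le_of_abs_vertices_le (x := fun x : Mem O A M h × O × A => u x.1 x.2.1 x.2.2)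
      (f := fun u => deviation p φ D (tdForm h (fun z o a => u (z, o, a))
      (fun z t => if cv (z, t) then B else -B) (fun z t => if cw (z, t) then B else -B)))
      (fun x y α β hαβ => deviation_affine p φ D fun e => ?_)
      zero_le_one (fun cu => hv (cu, cv, cw)) fun i => hu _ _ _
    obtain rfl : β = 1 - α := by linarith
    simp only [tdForm, Pi.add_apply, Pi.smul_apply, smul_eq_mul]
    ring
  have h2 : ∀ cw : Mem O A M h × Fut O A K → Bool,
      |deviation p φ D (tdForm h u v (fun z t => if cw (z, t) then B else -B))| ≤ η := by
    intro cw
    refine abs_le_of_abs_vertices_le (x := fun x : Mem O A M (h + 1) × Fut O A K => v x.1 x.2)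
      (f := fun v => deviation p φ D (tdForm h u (fun z t => v (z, t))
      (fun z t => if cw (z, t) then B else -B)))
      (fun x y α β hαβ => deviation_affine p φ D fun e => ?_)
      hBB (fun cv => h1 cv cw) fun i => hv' _ _
    obtain rfl : β = 1 - α := by linarith
    simp only [tdForm, Pi.add_apply, Pi.smul_apply, smul_eq_mul]
    ring
  refine abs_le_of_abs_vertices_le (x := fun x : Mem O A M h × Fut O A K => w x.1 x.2)
    (f := fun w => deviation p φ D (tdForm h u v (fun z t => w (z, t))))
    (fun x y α β hαβ => deviation_affine p φ D fun e => ?_)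
    hBB (fun cw => h2 cw) fun i => hw _ _
  obtain rfl : β = 1 - α := by linarith
  simp only [tdForm, Pi.add_apply, Pi.smul_apply, smul_eq_mul]
  ring

theorem abs_initDeviation_le_of_vertices {B η : ℝ} (hB : 0 ≤ B) (D : Batch O A (H + K) m)
    (hv : ∀ c : Fut O A K → Bool,
      |(∑ i, if c (futAt K (D i).1 0 (by omega)) then B else -B) / m -
        expect p fun x => if c (futAt K (φ x).1 0 (by omega)) then B else -B| ≤ η)
    {g : Link O A M K} (hg : ∀ h z t, |g h z t| ≤ B) :
    |empInit g D - expect p fun x => g 0 emptyMem (futAt K (φ x).1 0 (by omega))| ≤ η := by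
  refine abs_le_of_abs_vertices_le (f := fun w : Fut O A K → ℝ =>
    (∑ i, w (futAt K (D i).1 0 (by omega))) / m -
      expect p fun x => w (futAt K (φ x).1 0 (by omega))) (fun x y α β hαβ => ?_)
    (by linarith : -B ≤ B) hv fun t => abs_le.1 (hg 0 emptyMem t)
  simp only [Pi.add_apply, Pi.smul_apply, smul_eq_mul, expect_add, expect_mul_left,
    sum_add_distrib, ← mul_sum]
  ring

end Deviation

/-! ### The good event and its probability. -/

namespace POMDP

variable {S O A : Type*} [Fintype S] [Fintype O] [Fintype A] (P : POMDP S O A) {H M K m : ℕ}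

theorem batch_prob_le {ι : Type*} [Finite ι] (ρ : Policy O A M) (N : ℕ)
    {f : ι → Episode O A N → ℝ} {C η : ℝ} (hC : 0 < C) (hη : 0 < η) (hm : 0 < m)
    (hf : ∀ j τ, |f j (obs τ, P.rew 0 τ)| ≤ C) :
    (indep m fun _ => P.episode ρ N).toOuterMeasure {D | ∃ j, η < |(∑ i, f j (D i)) / m -
      expect (P.traj ρ N) fun τ => f j (obs τ, P.rew 0 τ)|} ≤
    ENNReal.ofReal (Nat.card ι * (2 * Real.exp (-(m * η ^ 2 / (16 * C ^ 2))))) := by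
  simp only [episode]
  rw [indep_map (fun _ => P.traj ρ N), PMF.toOuterMeasure_map_apply]
  exact prob_exists_mean_sub_le (P.traj ρ N) (f := fun j τ => f j (obs τ, P.rew 0 τ)) hC hη hf hm

variable [Nonempty A]

/-- The policy `thenUnif π H` is on-policy for all rewarded steps; the `K` uniform steps appended to
it do not affect their law. -/
theorem expect_return (π : Policy O A M) :
    (expect (P.traj (thenUnif π H) (H + K)) fun τ =>
      ∑ j : Fin H, P.rew 0 τ ⟨j, by omega⟩) = P.J H π := by
  rw [expect_traj, J, expect_traj]
  refine expect_congr _ fun s => ?_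
  rw [← P.rollout_congr (π := thenUnif π H) H 0 emptyMem s fun j _ hj => by
    simp [thenUnif, show j < H by omega], ← P.rollout_take _ (Nat.le_add_right H K) 0 emptyMem s,
    expect_map]
  rfl

/-- Expectation of the first-step link function under uniform actions. -/
noncomputable def initMean (g : Link O A M K) : ℝ :=
  expect P.init fun s => P.futMean (g 0 emptyMem) s

theorem expect_init (g : Link O A M K) :
    (expect (P.traj (unifPolicy O A M) (H + K)) fun τ =>
      g 0 emptyMem (futAt K (obs τ) 0 (by omega))) = P.initMean g := by
  have h := P.expect_traj_futAt (K := K) (H := H) (unifPolicy O A M) 0 (Nat.zero_le _) (g 0)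
  rw [occupancy, expect_map] at h
  rw [initMean, ← h]
  simp only [memAt_zero]
  rfl

/-- The initial data set estimates all bounded first-step link functions. -/
def GoodInit (B η : ℝ) (D : Batch O A (H + K) m) : Prop :=
  ∀ g ∈ boundedLinks O A H M K B, |empInit g D - P.initMean g| ≤ η

/-- The data of an iteration with policy `π'` estimate all Bellman errors and the return. -/
def GoodRound (B η : ℝ) (π' : Policy O A M) (X : Round O A (H + K) H m) : Prop :=
  (∀ (h : Fin H) (π : Policy O A M), ∀ g ∈ boundedLinks O A H M K B,
    |empLoss π g h (X h.castSucc) + P.bellmanError π g π' h| ≤ η) ∧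
  |empReturn (X (Fin.last H)) - P.J H π'| ≤ η

omit [Fintype O] [Fintype A] [Nonempty A] in
theorem abs_le_of_mem_boundedLinks {B : ℝ} (hB : 0 ≤ B) {g : Link O A M K}
    (hg : g ∈ boundedLinks O A H M K B) (h : ℕ) (z : Mem O A M h) (t : Fut O A K) :
    |g h z t| ≤ B := by
  rcases lt_or_ge h H with h' | h'
  · exact hg.1 h h' z t
  · rw [hg.2 h h']
    simpa using hB

theorem prob_not_goodInit_le {B η : ℝ} (hB : 0 < B) (hη : 0 < η) (hm : 0 < m) :
    (indep m fun _ => P.episode (unifPolicy O A M) (H + K)).toOuterMeasure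
      {D | ¬P.GoodInit (M := M) B η D} ≤
    ENNReal.ofReal (Nat.card (Fut O A K → Bool) *
      (2 * Real.exp (-(m * η ^ 2 / (16 * B ^ 2))))) := by
  have h1 := P.batch_prob_le (unifPolicy O A M) (H + K) (f := fun (c : Fut O A K → Bool) e =>
    if c (futAt K e.1 0 (by omega)) then B else -B) hB hη hm fun c τ => by
      split_ifs <;> simp [abs_of_pos hB]
  refine le_trans (MeasureTheory.measure_mono fun D hD => ?_) h1
  by_contra hc
  refine hD fun g hg => ?_
  rw [Set.mem_ofPred_eq, not_exists] at hc
  have := abs_initDeviation_le_of_vertices (P.traj (unifPolicy O A M) (H + K))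
    (fun τ => (obs τ, P.rew 0 τ)) hB.le D (fun c => not_lt.1 (hc c))
    (abs_le_of_mem_boundedLinks hB.le hg)
  rwa [P.expect_init] at this

theorem prob_not_goodRound_le
    (hr : ∀ h < H, ∀ s o a, 0 ≤ P.reward h s o a ∧ P.reward h s o a ≤ 1) {B η V : ℝ}
    (hB : 1 ≤ B) (hHB : H ≤ B) (hη : 0 < η) (hm : 0 < m) (hV1 : 1 ≤ V)
    (hV : ∀ h : Fin H, (Nat.card (TDVertex O A M K h) : ℝ) ≤ V) (π' : Policy O A M) :
    (Learner.roundLaw P H K m π').toOuterMeasure {X | ¬P.GoodRound B η π' X} ≤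
    ENNReal.ofReal ((H + 1) * (V *
      (2 * Real.exp (-(m * η ^ 2 / (16 * (3 * Fintype.card A * B) ^ 2)))))) := by
  set C : ℝ := 3 * Fintype.card A * B with hC
  set E : ℝ := 2 * Real.exp (-(m * η ^ 2 / (16 * C ^ 2))) with hE
  have hE0 : 0 ≤ E := by positivity
  have hA : (1 : ℝ) ≤ Fintype.card A := by exact_mod_cast Fintype.card_pos
  have hBC : B ≤ C := by nlinarith
  have hC0 : 0 < C := by linarith
  have hrew : ∀ (τ : Fin (H + K) → S × O × A) (j : Fin H), |P.rew 0 τ ⟨j, by omega⟩| ≤ 1 := by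
    intro τ j
    have := hr (0 + j) (by have := j.isLt; omega) (τ ⟨j, by omega⟩).1 (τ ⟨j, by omega⟩).2.1
      (τ ⟨j, by omega⟩).2.2
    rw [rew, abs_of_nonneg this.1]
    exact this.2
  have hmarg : ∀ (i : Fin (H + 1)) (s : Set (Batch O A (H + K) m)),
      (Learner.roundLaw P H K m π').toOuterMeasure {X | X i ∈ s} =
        (indep m fun _ => P.episode (thenUnif π' i) (H + K)).toOuterMeasure s := by
    intro i s
    rw [← indep_map_apply (fun h : Fin (H + 1) =>
      indep m fun _ => P.episode (thenUnif π' h) (H + K)) i, PMF.toOuterMeasure_map_apply]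
    rfl
  -- One event per data set: vertex deviations for each step, the return for the last. The index
  -- `Unit` turns the latter into a family with one member, so that `batch_prob_le` covers both.
  let bad : Fin (H + 1) → Set (Batch O A (H + K) m) := Fin.lastCases
    {D | ∃ _ : Unit, η < |(∑ i, ∑ j : Fin H, (D i).2 ⟨j, by omega⟩) / m -
      expect (P.traj (thenUnif π' H) (H + K)) fun τ => ∑ j : Fin H, P.rew 0 τ ⟨j, by omega⟩|}
    fun h => {D | ∃ c : TDVertex O A M K h, η < |(∑ i, vertexLoss h B c (D i)) / m -
      expect (P.traj (thenUnif π' h) (H + K)) fun τ => vertexLoss h B c (obs τ, P.rew 0 τ)|}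
  have hbad : ∀ i, (Learner.roundLaw P H K m π').toOuterMeasure {X | X i ∈ bad i} ≤
      ENNReal.ofReal (V * E) := by
    intro i
    rw [hmarg]
    cases i using Fin.lastCases with
    | last =>
      simp only [bad, Fin.lastCases_last, Fin.val_last]
      refine (P.batch_prob_le (thenUnif π' H) (H + K)
        (f := fun (_ : Unit) e => ∑ j : Fin H, e.2 ⟨j, by omega⟩) hC0 hη hm fun _ τ => ?_).trans ?_
      · refine (abs_sum_le_sum_abs _ _).trans ((sum_le_sum fun j _ => hrew τ j).trans ?_)
        simp only [sum_const, card_univ, Fintype.card_fin, nsmul_eq_mul, mul_one]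
        linarith
      · refine ENNReal.ofReal_le_ofReal ?_
        rw [Nat.card_unique, Nat.cast_one]
        exact mul_le_mul_of_nonneg_right hV1 hE0
    | cast h =>
      simp only [bad, Fin.lastCases_castSucc, Fin.val_castSucc]
      refine (P.batch_prob_le (thenUnif π' h) (H + K) (f := vertexLoss h B) hC0 hη hm
        fun c τ => abs_vertexLoss_le h hB c _ (hrew τ h)).trans ?_
      exact ENNReal.ofReal_le_ofReal (mul_le_mul_of_nonneg_right (hV h) hE0)
  have hsub : {X | ¬P.GoodRound B η π' X} ⊆ ⋃ i, {X | X i ∈ bad i} := by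
    intro X hX
    by_contra hc
    simp only [Set.mem_iUnion, Set.mem_ofPred_eq, not_exists] at hc
    refine hX ⟨fun h π g hg => ?_, ?_⟩
    · have h1 := hc h.castSucc
      simp only [bad, Fin.lastCases_castSucc, Set.mem_ofPred_eq, not_exists, not_lt] at h1
      have := abs_deviation_le_of_vertices (P.traj (thenUnif π' h) (H + K))
        (fun τ => (obs τ, P.rew 0 τ)) h (zero_le_one.trans hB) _ h1
        (u := fun z o a => (π h z o a).toReal) (fun z o a => ⟨ENNReal.toReal_nonneg,
          ENNReal.toReal_le_of_le_ofReal zero_le_one (by simpa using PMF.coe_le_one _ _)⟩)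
        (v := g (h + 1)) (w := g h)
        (fun z t => abs_le.1 (abs_le_of_mem_boundedLinks (zero_le_one.trans hB) hg _ z t))
        (fun z t => abs_le.1 (abs_le_of_mem_boundedLinks (zero_le_one.trans hB) hg _ z t))
      rw [← sub_neg_eq_add, ← P.expect_tdLoss]
      exact this
    · have h1 := hc (Fin.last H)
      simp only [bad, Fin.lastCases_last, Set.mem_ofPred_eq, not_exists, not_lt] at h1
      have := h1 ()
      rwa [P.expect_return] at this
  refine (MeasureTheory.measure_mono hsub).trans
    ((MeasureTheory.measure_iUnion_fintype_le _ _).trans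
    ((sum_le_sum fun i _ => hbad i).trans ?_))
  rw [sum_const, card_univ, Fintype.card_fin, nsmul_eq_mul, ← ENNReal.ofReal_natCast,
    ← ENNReal.ofReal_mul (Nat.cast_nonneg _), Nat.cast_add_one]

end POMDP

namespace Learner

variable {S O A : Type*} [Fintype S] [Fintype O] [Fintype A] [Nonempty A] {H M K m T : ℕ}
  {G : Set (Link O A M K)} {R : ℝ} (L : Learner O A H M K m T G R) (P : POMDP S O A)

/-- All data sets of the first `t` iterations give good estimates. -/
def GoodData (B η : ℝ) (t : ℕ)
    (ω : Batch O A (H + K) m × (Fin t → Round O A (H + K) H m)) : Prop :=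
  P.GoodInit (M := M) B η ω.1 ∧
    ∀ i : Fin t, P.GoodRound B η (L.policyAt ω.1 i fun j => ω.2 (Fin.castLE i.isLt.le j)) (ω.2 i)

/-- Given the past, the policy of the next iteration is fixed, so the bound for one round applies
conditionally. The factor counts the data sets: one initial, and `H + 1` per round. -/
theorem prob_not_goodData_le
    (hr : ∀ h < H, ∀ s o a, 0 ≤ P.reward h s o a ∧ P.reward h s o a ≤ 1) {B η V : ℝ}
    (hB : 1 ≤ B) (hHB : H ≤ B) (hη : 0 < η) (hm : 0 < m) (hV1 : 1 ≤ V)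
    (hV0 : (Nat.card (Fut O A K → Bool) : ℝ) ≤ V)
    (hV : ∀ h : Fin H, (Nat.card (TDVertex O A M K h) : ℝ) ≤ V) (t : ℕ) :
    (L.dataLaw P t).toOuterMeasure {ω | ¬L.GoodData P B η t ω} ≤
    ENNReal.ofReal ((1 + t * (H + 1)) * (V *
      (2 * Real.exp (-(m * η ^ 2 / (16 * (3 * Fintype.card A * B) ^ 2)))))) := by
  have hA : (1 : ℝ) ≤ Fintype.card A := by exact_mod_cast Fintype.card_pos
  induction t with
  | zero =>
    rw [dataLaw, PMF.toOuterMeasure_map_apply]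
    refine le_trans (MeasureTheory.measure_mono fun D hD => ?_)
      ((P.prob_not_goodInit_le (M := M) (zero_lt_one.trans_le hB) hη hm).trans
        (ENNReal.ofReal_le_ofReal ?_))
    · exact fun h => hD ⟨h, fun i => i.elim0⟩
    · rw [Nat.cast_zero, zero_mul, add_zero, one_mul]
      have : B ≤ 3 * Fintype.card A * B := by nlinarith
      gcongr
  | succ t ih =>
    rw [dataLaw]
    refine (toOuterMeasure_bind_le_add _ _ _ _ (ENNReal.ofReal ((H + 1) * (V *
      (2 * Real.exp (-(m * η ^ 2 / (16 * (3 * Fintype.card A * B) ^ 2)))))))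
      fun ω hω => ?_).trans ((add_le_add_left ih _).trans ?_)
    · rw [PMF.toOuterMeasure_map_apply]
      refine le_trans (MeasureTheory.measure_mono fun X hX => ?_)
        (P.prob_not_goodRound_le hr hB hHB hη hm hV1 hV (L.policyAt ω.1 t ω.2))
      rw [Set.mem_ofPred_eq, not_not] at hω
      refine fun h => hX ⟨hω.1, fun i => ?_⟩
      cases i using Fin.lastCases with
      | last =>
        -- Appending a round changes neither the earlier rounds nor the policies computed from them.
        have : (fun j : Fin t => (Fin.snoc ω.2 X : Fin (t + 1) → Round O A (H + K) H m)
            (Fin.castLE (Fin.last t).isLt.le j)) = ω.2 :=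
          funext fun j => Fin.snoc_castSucc (α := fun _ => Round O A (H + K) H m) X ω.2 j
        simp only [Fin.snoc_last]
        exact (congrArg (fun D => P.GoodRound B η (L.policyAt ω.1 t D) X) this).mpr h
      | cast i =>
        have : (fun j : Fin i => (Fin.snoc ω.2 X : Fin (t + 1) → Round O A (H + K) H m)
            (Fin.castLE i.castSucc.isLt.le j)) = fun j => ω.2 (Fin.castLE i.isLt.le j) :=
          funext fun j => Fin.snoc_castSucc (α := fun _ => Round O A (H + K) H m) X ω.2
            (Fin.castLE i.isLt.le j)
        simp only [Fin.snoc_castSucc]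
        exact (congrArg (fun D => P.GoodRound B η (L.policyAt ω.1 i D) (ω.2 i)) this).mpr (hω.2 i)
    · rw [← ENNReal.ofReal_add (by positivity) (by positivity)]
      refine ENNReal.ofReal_le_ofReal (le_of_eq ?_)
      push_cast
      ring

end Learner

/-! ### Performance difference and small on-policy errors. -/

namespace POMDP

variable {S O A : Type*} [Fintype S] [Fintype O] [Fintype A] [Nonempty A] (P : POMDP S O A)
  {H M K : ℕ}

/-- Performance difference: the on-policy Bellman errors sum to the gap between the predicted and
the actual value. -/
theorem sum_bellmanError (π : Policy O A M) {g : Link O A M K} (h0 : ∀ h ≥ H, g h = 0) :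
    ∑ h : Fin H, P.bellmanError π g π h = P.initMean g - P.J H π := by
  -- Predicted minus actual value from step `h` on. By the recursion for `occupancy`, each Bellman
  -- error is the difference of its means at `h` and `h + 1`; it vanishes at `H`.
  let F : (h : ℕ) → Mem O A M h × S → ℝ := fun h x =>
    P.futMean (g h x.1) x.2 - P.value π (H - h) h x.1 x.2
  have hstep : ∀ h : Fin H, P.bellmanError π g π h =
      expect (P.occupancy π h) (F h) - expect (P.occupancy π (h + 1)) (F (h + 1)) := by
    intro h
    have h2 : H - (h : ℕ) = H - (h + 1) + 1 := by have := h.isLt; omega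
    simp only [bellmanError_eq, occupancy, expect_bind, expect_map]
    rw [← expect_sub]
    refine expect_congr _ fun x => ?_
    simp only [residual, F]
    rw [h2, value_succ]
    simp only [expect_add, expect_sub]
    ring
  simp only [hstep]
  rw [Fin.sum_univ_eq_sum_range fun h => expect (P.occupancy π h) (F h) -
    expect (P.occupancy π (h + 1)) (F (h + 1)),
    sum_range_sub' fun h => expect (P.occupancy π h) (F h)]
  have hH : expect (P.occupancy π H) (F H) = 0 := by
    simp [F, h0 H le_rfl, futMean_zero, value_zero, expect_def]
  rw [hH, sub_zero, occupancy, expect_map]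
  simp only [F, expect_sub, Nat.sub_zero, initMean, J_eq]

theorem bellmanError_eq_zero {π : Policy O A M} {g : Link O A M K} (h0 : ∀ h ≥ H, g h = 0)
    (hg : P.IsValueLink H π g) (π' : Policy O A M) (h : Fin H) : P.bellmanError π g π' h = 0 := by
  rw [bellmanError_eq]
  simp only [P.residual_eq_zero h0 hg h, expect_const]

/-- If the policies and link functions of a long enough sequence have small Bellman errors under
all earlier policies, one of them has small Bellman errors under its own policy. -/
theorem exists_sum_bellmanError_sq_le
    (hr : ∀ h < H, ∀ s o a, 0 ≤ P.reward h s o a ∧ P.reward h s o a ≤ 1) {B η d l : ℝ}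
    (hB : 1 ≤ B) (hd : ∀ h, (Fintype.card (Mem O A M h × S) : ℝ) ≤ d) (hl : 0 < l)
    (x : ℕ → Policy O A M × Link O A M K) {T : ℕ} (hT : 2 ≤ T)
    (hx : ∀ t, 1 ≤ t → t < T → (x t).2 ∈ boundedLinks O A H M K B)
    (he : ∀ t, 1 ≤ t → t < T → ∀ i < t, ∀ h : Fin H,
      |P.bellmanError (x t).1 (x t).2 (x i).1 h| ≤ 2 * η)
    (hTd : H * d * Real.log (d + T / l) ≤ T - 1) :
    ∃ t, 1 ≤ t ∧ t < T ∧ (∑ h : Fin H, P.bellmanError (x t).1 (x t).2 (x t).1 h) ^ 2 ≤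
      H * ((l * (9 * B ^ 2 * d) + 4 * T * η ^ 2) *
        (2 * (H * d * Real.log (d + T / l) / (T - 1)))) := by
  classical
  have hT2 : (2 : ℝ) ≤ T := by exact_mod_cast hT
  have hT1 : (0 : ℝ) < T - 1 := by linarith
  have hd1 : 1 ≤ d := by
    obtain ⟨s, -⟩ := P.init.support_nonempty
    obtain ⟨o, -⟩ := (P.emit s).support_nonempty
    have : Nonempty (Mem O A M 0 × S) := ⟨(emptyMem, s)⟩
    have h1 : (1 : ℝ) ≤ Fintype.card (Mem O A M 0 × S) := by exact_mod_cast Fintype.card_pos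
    exact h1.trans (hd 0)
  set X : (h : ℕ) → ℕ → Mem O A M h × S → ℝ := fun h t y => (P.occupancy (x t).1 h y).toReal with hX
  set w : (h : ℕ) → ℕ → Mem O A M h × S → ℝ :=
    fun h t y => P.residual (x t).1 (x t).2 h y.1 y.2 with hw
  have hX1 : ∀ h t, X h t ⬝ᵥ X h t ≤ 1 := by
    intro h t
    rw [← sum_toReal_eq_one (P.occupancy (x t).1 h)]
    exact sum_le_sum fun y _ => mul_le_of_le_one_left ENNReal.toReal_nonneg
      (ENNReal.toReal_le_of_le_ofReal zero_le_one (by simpa using PMF.coe_le_one _ y))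
  have hbr : ∀ (h : Fin H) t i, w h t ⬝ᵥ X h i = P.bellmanError (x t).1 (x t).2 (x i).1 h := by
    intro h t i
    rw [bellmanError_eq, expect_def]
    exact sum_congr rfl fun y _ => mul_comm _ _
  choose Y hY0 hYs hYw using fun h => exists_elliptical_potential hl (hX1 h)
  set Lg := Real.log (d + T / l) with hLg
  have hLg0 : 0 ≤ Lg := Real.log_nonneg (by have : 0 ≤ T / l := by positivity
                                            linarith)
  -- Pigeonhole for the potentials summed over steps, so that a single `t` serves every `h`. Index
  -- `0` is left out, because the hypotheses say nothing about its link.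
  have hsum : ∑ t ∈ Ico 1 T, ∑ h : Fin H, Y h t ≤
      ∑ t ∈ Ico 1 T, H * d * Lg / (T - 1) := by
    have h1 : ∑ t ∈ Ico 1 T, (H * d * Lg / (T - 1) : ℝ) = H * d * Lg := by
      rw [sum_const, Nat.card_Ico, nsmul_eq_mul, Nat.cast_sub (by omega), Nat.cast_one]
      field_simp
    rw [h1, sum_comm]
    calc ∑ h : Fin H, ∑ t ∈ Ico 1 T, Y h t ≤ ∑ h : Fin H, d * Lg := by
          refine sum_le_sum fun h _ => ?_
          refine (sum_le_sum_of_subset_of_nonneg (fun t ht => mem_range.2 (mem_Ico.1 ht).2)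
            fun t _ _ => hY0 h t).trans ((hYs h T).trans ?_)
          have : Nonempty (Mem O A M h × S) := by
            obtain ⟨y, -⟩ := (P.occupancy (x 0).1 h).support_nonempty
            exact ⟨y⟩
          have h2 : (0 : ℝ) < Fintype.card (Mem O A M h × S) := by exact_mod_cast Fintype.card_pos
          exact mul_le_mul (hd h) (Real.log_le_log (by positivity) (by linarith [hd h]))
            (Real.log_nonneg (by
              have h3 : (1 : ℝ) ≤ Fintype.card (Mem O A M h × S) := by
                exact_mod_cast Fintype.card_pos
              have : 0 ≤ T / l := by positivity
              linarith)) (by linarith)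
      _ = H * d * Lg := by
          rw [sum_const, card_univ, Fintype.card_fin, nsmul_eq_mul, mul_assoc]
  obtain ⟨t, ht, hYt⟩ := exists_le_of_sum_le ⟨1, mem_Ico.2 ⟨le_rfl, by omega⟩⟩ hsum
  obtain ⟨ht1, htT⟩ := mem_Ico.1 ht
  refine ⟨t, ht1, htT, ?_⟩
  set κ : ℝ := H * d * Lg / (T - 1) with hκ
  -- Potentials at most `1` allow the linearization `exp Y - 1 ≤ 2 Y` below.
  have hκ1 : κ ≤ 1 := (div_le_one hT1).2 hTd
  set Wb : ℝ := l * (9 * B ^ 2 * d) + 4 * T * η ^ 2 with hWb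
  have hWb0 : 0 ≤ Wb := by positivity
  have hone : ∀ h : Fin H, (P.bellmanError (x t).1 (x t).2 (x t).1 h) ^ 2 ≤ Wb * (2 * Y h t) := by
    intro h
    have hYle : Y h t ≤ 1 := (single_le_sum (f := fun h : Fin H => Y h t)
      (fun h _ => hY0 h t) (mem_univ h)).trans (hYt.trans hκ1)
    have hexp : Real.exp (Y h t) - 1 ≤ 2 * Y h t := by
      have := Real.abs_exp_sub_one_le (x := Y h t) (by rwa [abs_of_nonneg (hY0 h t)])
      rw [abs_of_nonneg (hY0 h t)] at this
      exact (le_abs_self _).trans this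
    have hexp0 : 0 ≤ Real.exp (Y h t) - 1 := by linarith [Real.add_one_le_exp (Y h t), hY0 h t]
    have hww : w h t ⬝ᵥ w h t ≤ 9 * B ^ 2 * d := by
      calc w h t ⬝ᵥ w h t ≤ ∑ _y : Mem O A M h × S, 9 * B ^ 2 := by
            refine sum_le_sum fun y _ => ?_
            have := P.abs_residual_le hr (x t).1 (abs_le_of_mem_boundedLinks
              (zero_le_one.trans hB) (hx t ht1 htT)) h y.1 y.2
            have h3 : |w h t y| ≤ 3 * B := this.trans (by linarith)
            have h4 := sq_le_sq' (abs_le.1 h3).1 (abs_le.1 h3).2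
            linarith [sq (w h t y)]
        _ ≤ 9 * B ^ 2 * d := by
            rw [sum_const, card_univ, nsmul_eq_mul, mul_comm]
            exact mul_le_mul_of_nonneg_left (hd h) (by positivity)
    have hpast : ∑ i ∈ range t, (w h t ⬝ᵥ X h i) ^ 2 ≤ 4 * T * η ^ 2 := by
      calc ∑ i ∈ range t, (w h t ⬝ᵥ X h i) ^ 2 ≤ ∑ i ∈ range t, (2 * η) ^ 2 := by
            refine sum_le_sum fun i hi => ?_
            have := he t ht1 htT i (mem_range.1 hi) h
            rw [hbr]
            exact sq_le_sq' (abs_le.1 this).1 (abs_le.1 this).2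
        _ = t * (2 * η) ^ 2 := by rw [sum_const, card_range, nsmul_eq_mul]
        _ ≤ T * (2 * η) ^ 2 := mul_le_mul_of_nonneg_right (by exact_mod_cast htT.le) (sq_nonneg _)
        _ = 4 * T * η ^ 2 := by ring
    rw [← hbr]
    exact (hYw h t (w h t)).trans (mul_le_mul (add_le_add (mul_le_mul_of_nonneg_left hww hl.le)
      hpast) hexp hexp0 hWb0)
  calc (∑ h : Fin H, P.bellmanError (x t).1 (x t).2 (x t).1 h) ^ 2
      ≤ H * ∑ h : Fin H, (P.bellmanError (x t).1 (x t).2 (x t).1 h) ^ 2 := by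
        simpa using sq_sum_le_card_mul_sum_sq (s := (univ : Finset (Fin H)))
          (f := fun h => P.bellmanError (x t).1 (x t).2 (x t).1 h)
    _ ≤ H * (Wb * (2 * κ)) := by
        refine mul_le_mul_of_nonneg_left ((sum_le_sum fun h _ => hone h).trans ?_)
          (Nat.cast_nonneg _)
        rw [← mul_sum, ← mul_sum]
        exact mul_le_mul_of_nonneg_left (by linarith) hWb0

end POMDP

/-! ### Optimism and suboptimality on good data. -/

namespace Learner

variable {S O A : Type*} [Fintype S] [Fintype O] [Fintype A] [Nonempty A]
  {H M K m T : ℕ} {G : Set (Link O A M K)} {η : ℝ} (L : Learner O A H M K m T G (η ^ 2))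
  (P : POMDP S O A)

/-- On good data, the selected pair satisfies the constraints, and it is optimistic with respect to
every policy. -/
theorem select_spec {B : ℝ} (hGc : IsCompact G) (hGB : G ⊆ boundedLinks O A H M K B)
    (hv : ∀ π : Policy O A M, ∃ g ∈ G, P.IsValueLink H π g)
    (ω : Batch O A (H + K) m × (Fin T → Round O A (H + K) H m)) (hω : L.GoodData P B η T ω)
    (t : ℕ) (ht : t + 1 ≤ T) :
    Feasible G (η ^ 2) (fun j : Fin (t + 1) => ω.2 (Fin.castLE ht j))
      (L.select ω.1 t fun j => ω.2 (Fin.castLE ht j)) ∧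
    ∀ π : Policy O A M,
      P.J H π - 2 * η ≤ P.initMean (L.select ω.1 t fun j => ω.2 (Fin.castLE ht j)).2 := by
  -- A value link has zero Bellman error, so on good data its empirical losses are at most `η`; this
  -- explains the constraint level `η ^ 2`.
  have hfeas : ∀ π : Policy O A M, ∀ g ∈ G, P.IsValueLink H π g →
      Feasible G (η ^ 2) (fun j : Fin (t + 1) => ω.2 (Fin.castLE ht j)) (π, g) := by
    intro π g hg hgπ
    refine ⟨hg, fun i h => ?_⟩
    have h1 := (hω.2 (Fin.castLE ht i)).1 h π g (hGB hg)
    rw [P.bellmanError_eq_zero (hGB hg).2 hgπ, add_zero] at h1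
    exact sq_le_sq' (abs_le.1 h1).1 (abs_le.1 h1).2
  have hopt : Optimistic G (η ^ 2) ω.1 (fun j : Fin (t + 1) => ω.2 (Fin.castLE ht j))
      (L.select ω.1 t fun j => ω.2 (Fin.castLE ht j)) := by
    refine L.select_optimistic _ _ _ (exists_optimistic hGc _ _ _ ?_)
    obtain ⟨g, hg, hgπ⟩ := hv L.initial
    exact ⟨_, hfeas _ g hg hgπ⟩
  refine ⟨hopt.1, fun π => ?_⟩
  obtain ⟨g, hg, hgπ⟩ := hv π
  have h1 := hopt.2 (π, g) (hfeas π g hg hgπ)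
  have h2 := (abs_le.1 (hω.1 g (hGB hg))).1
  have h3 := (abs_le.1 (hω.1 _ (hGB hopt.1.1))).2
  have h4 := P.sum_bellmanError π (hGB hg).2
  simp only [P.bellmanError_eq_zero (hGB hg).2 hgπ, sum_const_zero] at h4
  linarith

theorem suboptimality_le
    (hr : ∀ h < H, ∀ s o a, 0 ≤ P.reward h s o a ∧ P.reward h s o a ≤ 1) {B d ε : ℝ} (hB : 1 ≤ B)
    (hd : ∀ h, (Fintype.card (Mem O A M h × S) : ℝ) ≤ d) (hd0 : 0 < d) (hη : 0 < η)
    (hGc : IsCompact G) (hGB : G ⊆ boundedLinks O A H M K B)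
    (hv : ∀ π : Policy O A M, ∃ g ∈ G, P.IsValueLink H π g) (hT : 2 ≤ T)
    (hTd : H * d * Real.log (d + 9 * B ^ 2 * d / η ^ 2) ≤ T - 1) (hε : 0 ≤ ε) (hηε : 8 * η ≤ ε)
    (hηε2 : 20 * H ^ 2 * d * η ^ 2 * Real.log (d + 9 * B ^ 2 * d / η ^ 2) ≤ (ε / 2) ^ 2)
    (ω : Batch O A (H + K) m × (Fin T → Round O A (H + K) H m)) (hω : L.GoodData P B η T ω)
    (π : Policy O A M) : P.J H π - P.J H (L.output ω.1 ω.2) ≤ ε := by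
  have hT2 : (2 : ℝ) ≤ T := by exact_mod_cast hT
  set x : ℕ → Policy O A M × Link O A M K := fun t => match t with
    | 0 => (L.initial, 0)
    | t + 1 => if h : t + 1 ≤ T then L.select ω.1 t fun j => ω.2 (Fin.castLE h j)
      else (L.initial, 0) with hx
  have hxs : ∀ t (ht : t + 1 ≤ T), x (t + 1) = L.select ω.1 t fun j => ω.2 (Fin.castLE ht j) :=
    fun t ht => dif_pos ht
  have hpol : ∀ t (ht : t ≤ T), L.policyAt ω.1 t (fun j => ω.2 (Fin.castLE ht j)) = (x t).1 := by
    intro t ht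
    cases t with
    | zero => rfl
    | succ t => rw [hxs t ht]; rfl
  have hspec := L.select_spec P hGc hGB hv ω hω
  have hround : ∀ i (hi : i < T), P.GoodRound B η (x i).1 (ω.2 ⟨i, hi⟩) := by
    intro i hi
    rw [← hpol i hi.le]
    exact hω.2 ⟨i, hi⟩
  -- The regularization term becomes `T η²`, of the order of the past errors `4 T η²`, and `T / l`
  -- no longer depends on `T`, so the condition on `T` is not circular.
  set l : ℝ := T * η ^ 2 / (9 * B ^ 2 * d) with hl
  have hl0 : 0 < l := by positivity
  have hTl : T / l = 9 * B ^ 2 * d / η ^ 2 := by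
    rw [hl]
    field_simp
  have hxG : ∀ t, 1 ≤ t → t < T → (x t).2 ∈ G := by
    intro t ht1 htT
    obtain ⟨t, rfl⟩ : ∃ t', t = t' + 1 := ⟨t - 1, by omega⟩
    rw [hxs t htT.le]
    exact (hspec t htT.le).1.1
  obtain ⟨t, ht1, htT, hsum⟩ := P.exists_sum_bellmanError_sq_le hr (η := η) hB hd hl0 x hT
    (fun t ht1 htT => hGB (hxG t ht1 htT)) (by
      intro t ht1 htT i hi h
      have h1 := (hround i (hi.trans htT)).1 h (x t).1 (x t).2 (hGB (hxG t ht1 htT))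
      have h2 : |empLoss (x t).1 (x t).2 h (ω.2 ⟨i, hi.trans htT⟩ h.castSucc)| ≤ η := by
        refine abs_le_of_sq_le_sq ?_ hη.le
        obtain ⟨t, rfl⟩ : ∃ t', t = t' + 1 := ⟨t - 1, by omega⟩
        rw [hxs t htT.le]
        exact (hspec t htT.le).1.2 ⟨i, hi⟩ h
      rw [abs_le] at h1 h2 ⊢
      constructor <;> linarith [h1.1, h1.2, h2.1, h2.2]) (by rwa [hTl])
  have hopt : P.J H π - 2 * η ≤ P.initMean (x t).2 := by
    obtain ⟨t, rfl⟩ : ∃ t', t = t' + 1 := ⟨t - 1, by omega⟩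
    rw [hxs t htT.le]
    exact (hspec t htT.le).2 π
  have hgap : P.initMean (x t).2 - P.J H (x t).1 ≤ ε / 2 := by
    rw [← P.sum_bellmanError (x t).1 (hGB (hxG t ht1 htT)).2]
    refine le_of_sq_le_sq (hsum.trans (le_trans ?_ hηε2)) (by positivity)
    rw [hTl]
    set Lg := Real.log (d + 9 * B ^ 2 * d / η ^ 2)
    have h1 : l * (9 * B ^ 2 * d) = T * η ^ 2 := by
      rw [hl]
      field_simp
    rw [h1]
    have hLg : 0 ≤ H * d * Lg := by
      rcases Nat.eq_zero_or_pos H with h0 | h0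
      · simp [h0]
      · have hd1 : 1 ≤ d := by
          obtain ⟨y, -⟩ := (P.occupancy (x 0).1 0).support_nonempty
          have : Nonempty (Mem O A M 0 × S) := ⟨y⟩
          have h1 : (1 : ℝ) ≤ Fintype.card (Mem O A M 0 × S) := by exact_mod_cast Fintype.card_pos
          exact h1.trans (hd 0)
        have : 0 ≤ Lg := Real.log_nonneg (by
          have : 0 ≤ 9 * B ^ 2 * d / η ^ 2 := by positivity
          linarith)
        positivity
    have h2 : (T : ℝ) * (H * d * Lg / (T - 1)) ≤ 2 * (H * d * Lg) := by
      rw [mul_div_assoc', div_le_iff₀ (by linarith)]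
      nlinarith
    calc (H : ℝ) * ((T * η ^ 2 + 4 * T * η ^ 2) * (2 * (H * d * Lg / (T - 1))))
        = 10 * H * η ^ 2 * (T * (H * d * Lg / (T - 1))) := by ring
      _ ≤ 10 * H * η ^ 2 * (2 * (H * d * Lg)) :=
          mul_le_mul_of_nonneg_left h2 (by positivity)
      _ = 20 * H ^ 2 * d * η ^ 2 * Lg := by ring
  set c := L.choose ω.1 ω.2 with hc
  have hout : L.output ω.1 ω.2 = (x c).1 := hpol c c.isLt.le
  have hbest := L.choose_best ω.1 ω.2 ⟨t, htT⟩
  have h1 := (abs_le.1 (hround t htT).2).1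
  have h2 := (abs_le.1 (hround c c.isLt).2).2
  rw [hout]
  change empReturn (ω.2 ⟨t, htT⟩ (Fin.last H)) ≤ empReturn (ω.2 c (Fin.last H)) at hbest
  -- Budget: `2η` from optimism, `ε / 2` from the on-policy gap, `2η` from comparing empirical
  -- returns, and `8η ≤ ε`.
  linarith

end Learner

/-! ### Counting vertices and choosing the parameters. -/

section Parameters

theorem card_fut_mul_le (O A : Type*) [Fintype O] [Nonempty O] [Fintype A] [Nonempty A]
    (M K h : ℕ) : Fintype.card (Mem O A M h) * Fintype.card (Fut O A K) ≤
      (Fintype.card O * Fintype.card A) ^ (M + K) := by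
  have hpos : 0 < Fintype.card O * Fintype.card A := Nat.mul_pos Fintype.card_pos Fintype.card_pos
  rw [pow_add]
  refine Nat.mul_le_mul ?_ ?_
  · rw [Fintype.card_fun, Fintype.card_prod, Fintype.card_fin]
    exact Nat.pow_le_pow_right hpos (min_le_right _ _)
  · rw [Fintype.card_prod, Fintype.card_fun, Fintype.card_fun, Fintype.card_fin, Fintype.card_fin,
      mul_pow]
    exact Nat.mul_le_mul_left _ (Nat.pow_le_pow_right Fintype.card_pos (Nat.sub_le _ _))

/-- Since `1 ≤ K`, the current observation and action are absorbed by the `K`-th power. -/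
theorem card_obs_action_mul_le (O A : Type*) [Fintype O] [Nonempty O] [Fintype A] [Nonempty A]
    (M h : ℕ) {K : ℕ} (hK : 1 ≤ K) : Fintype.card (Mem O A M h × O × A) ≤
      (Fintype.card O * Fintype.card A) ^ (M + K) := by
  have hpos : 0 < Fintype.card O * Fintype.card A := Nat.mul_pos Fintype.card_pos Fintype.card_pos
  rw [pow_add, Fintype.card_prod, Fintype.card_prod]
  refine Nat.mul_le_mul ?_ (Nat.le_self_pow (by omega) _)
  rw [Fintype.card_fun, Fintype.card_prod, Fintype.card_fin]
  exact Nat.pow_le_pow_right hpos (min_le_right _ _)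

theorem card_bool_fun_le {α : Type*} [Fintype α] {n : ℕ} (h : Fintype.card α ≤ n) :
    Nat.card (α → Bool) ≤ 2 ^ n := by
  rw [Nat.card_fun, Nat.card_eq_fintype_card, Nat.card_eq_fintype_card, Fintype.card_bool]
  exact Nat.pow_le_pow_right two_pos h

theorem card_tdVertex_le (O A : Type*) [Fintype O] [Nonempty O] [Fintype A] [Nonempty A]
    (M h : ℕ) {K : ℕ} (hK : 1 ≤ K) : Nat.card (TDVertex O A M K h) ≤
      2 ^ (3 * (Fintype.card O * Fintype.card A) ^ (M + K)) := by
  have h1 := card_bool_fun_le (card_obs_action_mul_le O A M h hK)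
  have h2 := card_bool_fun_le (α := Mem O A M (h + 1) × Fut O A K)
    ((Fintype.card_prod _ _).trans_le (card_fut_mul_le O A M K (h + 1)))
  have h3 := card_bool_fun_le (α := Mem O A M h × Fut O A K)
    ((Fintype.card_prod _ _).trans_le (card_fut_mul_le O A M K h))
  rw [Nat.card_prod, Nat.card_prod]
  refine (Nat.mul_le_mul h1 (Nat.mul_le_mul h2 h3)).trans (le_of_eq ?_)
  rw [← pow_add, ← pow_add]
  congr 1
  ring

theorem card_fut_bool_le (O A : Type*) [Fintype O] [Nonempty O] [Fintype A] [Nonempty A]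
    (M K : ℕ) : Nat.card (Fut O A K → Bool) ≤
      2 ^ (3 * (Fintype.card O * Fintype.card A) ^ (M + K)) := by
  refine (card_bool_fun_le (n := (Fintype.card O * Fintype.card A) ^ (M + K)) ?_).trans
    (Nat.pow_le_pow_right two_pos (by omega))
  exact (Nat.le_mul_of_pos_left _ Fintype.card_pos).trans (card_fut_mul_le O A M K 0)

/-- Numerical constants enter the logarithms only through a power of two above them and `log 2 <
0.7`. -/
theorem log_mul_pow_three_le {c q : ℝ} {k n : ℕ} (hc : 0 < c) (hq : 1 ≤ q) (hck : c ≤ 2 ^ k)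
    (hk : k * 0.7 ≤ (n : ℝ)) (hn : 3 ≤ n) : Real.log (c * q ^ 3) ≤ n * (1 + Real.log q) := by
  have h1 : Real.log c ≤ n := by
    refine (Real.log_le_log hc hck).trans ?_
    rw [Real.log_pow]
    exact (mul_le_mul_of_nonneg_left (by linarith [Real.log_two_lt_d9]) (Nat.cast_nonneg k)).trans
      hk
  have h2 : (3 : ℝ) ≤ n := by exact_mod_cast hn
  rw [Real.log_mul hc.ne' (by positivity), Real.log_pow]
  push_cast
  nlinarith [Real.log_nonneg hq]

/-- Here `q` is the quantity inside the final logarithm; it dominates `H d` because `ε σ ≤ H`. -/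
theorem le_complexity {d σ ε q : ℝ} {H : ℕ} (hd : 1 ≤ d) (hH : 1 ≤ (H : ℝ)) (hσ : 0 < σ)
    (hσ1 : σ ≤ 1) (hε : 0 < ε) (hεH : ε ≤ H) (hq : d * H ^ 2 / (ε * σ) ≤ q) :
    H * d ≤ q ∧ d ≤ q ∧ H ≤ q := by
  have hεσ0 : 0 < ε * σ := mul_pos hε hσ
  have hεσ : ε * σ ≤ H := (mul_le_of_le_one_right hε.le hσ1).trans hεH
  have hHd : H * d ≤ q := by
    refine le_trans ?_ hq
    rw [le_div_iff₀ hεσ0]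
    calc H * d * (ε * σ) ≤ H * d * H := mul_le_mul_of_nonneg_left hεσ (by positivity)
      _ = d * H ^ 2 := by ring
  exact ⟨hHd, (le_mul_of_one_le_left (by linarith) hH).trans hHd,
    (le_mul_of_one_le_right (by linarith) hd).trans hHd⟩

/-- The number of iterations and the accuracy. -/
theorem exists_iterations {d σ ε q : ℝ} {H : ℕ} (hd : 1 ≤ d) (hH : 1 ≤ (H : ℝ)) (hσ : 0 < σ)
    (hσ1 : σ ≤ 1) (hε : 0 < ε) (hεH : ε ≤ H) (hq : d * H ^ 2 / (ε * σ) ≤ q) :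
    ∃ (T : ℕ) (η : ℝ), 2 ≤ (T : ℝ) ∧ (T : ℝ) ≤ 22 * (H * d * (1 + Real.log q)) ∧ 0 < η ∧
      η ^ 2 = ε ^ 2 / (6400 * H ^ 2 * (d * (1 + Real.log q))) ∧
      H * d * Real.log (d + 9 * (H / σ) ^ 2 * d / η ^ 2) ≤ T - 1 ∧ 8 * η ≤ ε ∧
      20 * H ^ 2 * d * η ^ 2 * Real.log (d + 9 * (H / σ) ^ 2 * d / η ^ 2) ≤ (ε / 2) ^ 2 := by
  have hH0 : (0 : ℝ) < H := by linarith
  have hd0 : 0 < d := by linarith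
  obtain ⟨-, hdq, -⟩ := le_complexity hd hH hσ hσ1 hε hεH hq
  have hq1 : 1 ≤ q := hd.trans hdq
  have hlq : 0 ≤ Real.log q := Real.log_nonneg hq1
  obtain ⟨Λ, hΛ⟩ : ∃ Λ, Λ = 1 + Real.log q := ⟨_, rfl⟩
  rw [← hΛ]
  have hΛ1 : 1 ≤ Λ := by linarith
  have hΛ0 : 0 < Λ := by linarith
  have hΛq : Λ ≤ q := by linarith [Real.log_le_sub_one_of_pos (by linarith : 0 < q)]
  -- With the logarithm bounded by `20 Λ`, the last condition reads `400 H² d Λ η² ≤ ε² / 4`; this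
  -- choice makes the left side `ε² / 16`.
  obtain ⟨η, hη⟩ : ∃ η, η = ε / (80 * H * √(d * Λ)) := ⟨_, rfl⟩
  have hη0 : 0 < η := by rw [hη]; positivity
  have hη2 : η ^ 2 = ε ^ 2 / (6400 * H ^ 2 * (d * Λ)) := by
    rw [hη, div_pow, mul_pow, mul_pow, Real.sq_sqrt (by positivity)]
    norm_num
  have hLg : Real.log (d + 9 * (H / σ) ^ 2 * d / η ^ 2) ≤ 20 * Λ := by
    have h1 : 9 * (H / σ) ^ 2 * d / η ^ 2 = 57600 * (Λ * (d * H ^ 2 / (ε * σ)) ^ 2) := by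
      rw [hη2]
      field_simp
      ring
    have h2 : (d * H ^ 2 / (ε * σ)) ^ 2 ≤ q ^ 2 := pow_le_pow_left₀ (by positivity) hq 2
    have h4 : Λ * (d * H ^ 2 / (ε * σ)) ^ 2 ≤ q ^ 3 :=
      (mul_le_mul hΛq h2 (sq_nonneg _) (by linarith)).trans (le_of_eq (by ring))
    have h5 : q ≤ q ^ 3 := le_self_pow₀ hq1 (by norm_num)
    have h6 := log_mul_pow_three_le (c := 57601) (k := 16) (n := 20) (by norm_num) hq1
      (by norm_num) (by norm_num) (by norm_num)
    rw [← hΛ] at h6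
    refine le_trans (Real.log_le_log (by positivity) ?_) h6
    rw [h1]
    linarith
  have hHdΛ : 1 ≤ H * d * Λ :=
    one_le_mul_of_one_le_of_one_le (one_le_mul_of_one_le_of_one_le hH hd) hΛ1
  have hTlow := Nat.le_ceil (20 * (H * d * Λ))
  have hTup := Nat.ceil_lt_add_one (by linarith : 0 ≤ 20 * (H * d * Λ))
  -- The added `1` matches `T - 1` in the iteration condition; rounding gives `T ≤ 20 H d Λ + 2 ≤ 22
  -- H d Λ`.
  refine ⟨⌈20 * (H * d * Λ)⌉₊ + 1, η, ?_, ?_, hη0, hη2, ?_, ?_, ?_⟩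
  · push_cast
    linarith
  · push_cast
    linarith
  · push_cast
    calc H * d * Real.log (d + 9 * (H / σ) ^ 2 * d / η ^ 2)
        ≤ H * d * (20 * Λ) := mul_le_mul_of_nonneg_left hLg (by positivity)
      _ ≤ _ := by linarith
  · have h1 : 1 ≤ H * √(d * Λ) := one_le_mul_of_one_le_of_one_le hH
      (Real.one_le_sqrt.2 (one_le_mul_of_one_le_of_one_le hd hΛ1))
    rw [hη, mul_div_assoc', div_le_iff₀ (by positivity)]
    have := mul_le_mul_of_nonneg_left h1 hε.le
    linarith
  · calc 20 * H ^ 2 * d * η ^ 2 * Real.log (d + 9 * (H / σ) ^ 2 * d / η ^ 2)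
        ≤ 20 * H ^ 2 * d * η ^ 2 * (20 * Λ) := mul_le_mul_of_nonneg_left hLg (by positivity)
      _ = ε ^ 2 / 16 := by
        rw [hη2]
        field_simp
        norm_num
      _ ≤ (ε / 2) ^ 2 := by
        rw [div_pow]
        linarith [sq_nonneg ε]

/-- The number of episodes per data set, and the total number of episodes. -/
theorem exists_batch_size {a d D σ ε δ q V η : ℝ} {H T : ℕ} (ha : 1 ≤ a) (hd : 1 ≤ d) (hD : 1 ≤ D)
    (hH : 1 ≤ (H : ℝ)) (hσ : 0 < σ) (hσ1 : σ ≤ 1) (hε : 0 < ε) (hεH : ε ≤ H) (hδ : 0 < δ)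
    (hδ1 : δ < 1) (hq : d * H ^ 2 / (ε * σ) ≤ q) (hV0 : 0 ≤ V) (hV : V ≤ Real.exp (3 * D))
    (hT2 : 2 ≤ (T : ℝ)) (hT : (T : ℝ) ≤ 22 * (H * d * (1 + Real.log q))) (hη0 : 0 < η)
    (hη2 : η ^ 2 = ε ^ 2 / (6400 * H ^ 2 * (d * (1 + Real.log q)))) :
    ∃ m : ℕ, 0 < m ∧
      (1 + T * (H + 1)) * (V * (2 * Real.exp (-(m * η ^ 2 / (16 * (3 * a * (H / σ)) ^ 2))))) ≤ δ ∧
      (numEpisodes H m T : ℝ) ≤ 608256066 *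
        (a ^ 2 * d ^ 2 * D * H ^ 6 * (1 + Real.log (1 / δ)) / (ε ^ 2 * σ ^ 2)) *
        (1 + Real.log q) ^ 3 := by
  have hH0 : (0 : ℝ) < H := by linarith
  have hd0 : 0 < d := by linarith
  have hT0 : (0 : ℝ) < T := by linarith
  obtain ⟨hHd, hdq, hHq⟩ := le_complexity hd hH hσ hσ1 hε hεH hq
  have hq1 : 1 ≤ q := hd.trans hdq
  have hlq : 0 ≤ Real.log q := Real.log_nonneg hq1
  have hl1 : 0 ≤ Real.log (1 / δ) := Real.log_nonneg ((one_le_div hδ).2 hδ1.le)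
  have h132 := log_mul_pow_three_le (c := 132) (k := 8) (n := 6) (by norm_num) hq1
    (by norm_num) (by norm_num) (by norm_num)
  obtain ⟨Λ, hΛ⟩ : ∃ Λ, Λ = 1 + Real.log q := ⟨_, rfl⟩
  obtain ⟨l, hl⟩ : ∃ l, l = 1 + Real.log (1 / δ) := ⟨_, rfl⟩
  obtain ⟨C, hC⟩ : ∃ C, C = 3 * a * (H / σ) := ⟨_, rfl⟩
  rw [← hΛ] at hT hη2 h132 ⊢
  rw [← hl, ← hC]
  have hΛ1 : 1 ≤ Λ := by linarith
  have hΛ0 : 0 < Λ := by linarith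
  have hΛq : Λ ≤ q := by linarith [Real.log_le_sub_one_of_pos (by linarith : 0 < q)]
  replace hl1 : 1 ≤ l := by linarith
  have hC0 : 0 < C := by rw [hC]; positivity
  have hTH : 0 < 6 * T * (H : ℝ) := by positivity
  have hTH2 : 2 ≤ (T : ℝ) * H := by
    calc (2 : ℝ) = 2 * 1 := by norm_num
      _ ≤ T * H := mul_le_mul hT2 hH zero_le_one hT0.le
  have hHTH : (T : ℝ) ≤ T * H := le_mul_of_one_le_right hT0.le hH
  have hTH3 : (1 : ℝ) + T * (H + 1) ≤ 3 * (T * H) := by linarith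
  have hlogTH : Real.log (6 * T * H / δ) ≤ 6 * Λ + l - 1 := by
    have h2 : 6 * T * H ≤ 132 * q ^ 3 := by
      calc 6 * T * (H : ℝ) ≤ 6 * (22 * (H * d * Λ)) * H := by gcongr
        _ = 132 * (H * d * Λ * H) := by ring
        _ ≤ 132 * (q * q * q) := by gcongr
        _ = 132 * q ^ 3 := by ring
    have h3 : 6 * T * H / δ = 6 * T * H * (1 / δ) := by ring
    rw [h3, Real.log_mul hTH.ne' (by positivity)]
    have h4 := (Real.log_le_log hTH h2).trans h132
    push_cast at h4
    linarith
  have hlog0 : 0 ≤ Real.log (6 * T * H / δ) :=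
    Real.log_nonneg ((one_le_div hδ).2 (by linarith))
  -- Required exponent: `3 D` pays for the vertices, and the logarithm for at most `3 T H` data
  -- sets, the two tails and `δ`.
  obtain ⟨r, hr⟩ : ∃ r, r = 3 * D + Real.log (6 * T * H / δ) := ⟨_, rfl⟩
  have hr1 : r ≤ 10 * (D * Λ * l) := by
    have h1 : D ≤ D * (Λ * l) := le_mul_of_one_le_right (by linarith)
      (one_le_mul_of_one_le_of_one_le hΛ1 hl1)
    have h2 : Λ ≤ Λ * (D * l) := le_mul_of_one_le_right (by linarith)
      (one_le_mul_of_one_le_of_one_le hD hl1)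
    have h3 : l ≤ l * (D * Λ) := le_mul_of_one_le_right (by linarith)
      (one_le_mul_of_one_le_of_one_le hD hΛ1)
    linarith
  have hr0 : 0 < r := by linarith
  have hx0 : 0 < 16 * C ^ 2 / η ^ 2 * r := by positivity
  obtain ⟨m, hm⟩ : ∃ m : ℕ, m = ⌈16 * C ^ 2 / η ^ 2 * r⌉₊ := ⟨_, rfl⟩
  have hmx : 16 * C ^ 2 / η ^ 2 * r ≤ m := hm ▸ Nat.le_ceil _
  have hmx' : (m : ℝ) < 16 * C ^ 2 / η ^ 2 * r + 1 := hm ▸ Nat.ceil_lt_add_one hx0.le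
  refine ⟨m, hm ▸ Nat.ceil_pos.2 hx0, ?_, ?_⟩
  · have h1 : r ≤ m * η ^ 2 / (16 * C ^ 2) := by
      rw [le_div_iff₀ (by positivity)]
      calc r * (16 * C ^ 2) = 16 * C ^ 2 / η ^ 2 * r * η ^ 2 := by field_simp
        _ ≤ m * η ^ 2 := mul_le_mul_of_nonneg_right hmx (sq_nonneg η)
    have h2 : Real.exp (-(m * η ^ 2 / (16 * C ^ 2))) ≤
        Real.exp (-(3 * D)) * (δ / (6 * T * H)) := by
      calc Real.exp (-(m * η ^ 2 / (16 * C ^ 2))) ≤ Real.exp (-r) :=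
            Real.exp_le_exp.2 (neg_le_neg h1)
        _ = Real.exp (-(3 * D)) * (δ / (6 * T * H)) := by
            rw [hr, neg_add, Real.exp_add, Real.exp_neg (Real.log _),
              Real.exp_log (by positivity), inv_div]
    calc (1 + T * (H + 1)) * (V * (2 * Real.exp (-(m * η ^ 2 / (16 * C ^ 2)))))
        ≤ 3 * (T * H) * (Real.exp (3 * D) * (2 * (Real.exp (-(3 * D)) * (δ / (6 * T * H))))) := by
          gcongr
      _ = δ := by
          rw [Real.exp_neg]
          field_simp
          norm_num
  · obtain ⟨Q, hQ⟩ : ∃ Q, Q = a ^ 2 * (d * D * l * Λ ^ 2) * H ^ 4 / (ε ^ 2 * σ ^ 2) := ⟨_, rfl⟩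
    have hQ1 : 1 ≤ Q := by
      have h1 : (ε * σ) ^ 2 ≤ H ^ 4 :=
        (pow_le_pow_left₀ (by positivity) ((mul_le_of_le_one_right hε.le hσ1).trans hεH) 2).trans
          (pow_le_pow_right₀ hH (by norm_num))
      have h2 : 1 ≤ a ^ 2 * (d * D * l * Λ ^ 2) :=
        one_le_mul_of_one_le_of_one_le (one_le_pow₀ ha) (one_le_mul_of_one_le_of_one_le
          (one_le_mul_of_one_le_of_one_le (one_le_mul_of_one_le_of_one_le hd hD) hl1)
          (one_le_pow₀ hΛ1))
      rw [hQ, one_le_div (by positivity), ← mul_pow]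
      exact h1.trans (le_mul_of_one_le_left (by positivity) h2)
    -- `9216000 = 16 · 9 · 6400 · 10`, from the tail bound, `C²`, `η²` and `r ≤ 10 D Λ l`; rounding
    -- up adds at most `1 ≤ Q`.
    have hmQ : (m : ℝ) ≤ 9216001 * Q := by
      have h1 : 16 * C ^ 2 / η ^ 2 * r ≤ 9216000 * Q := by
        calc 16 * C ^ 2 / η ^ 2 * r ≤ 16 * C ^ 2 / η ^ 2 * (10 * (D * Λ * l)) :=
              mul_le_mul_of_nonneg_left hr1 (by positivity)
          _ = 9216000 * Q := by
              rw [hQ, hC, hη2]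
              field_simp
              norm_num
      linarith
    have hN : (numEpisodes H m T : ℝ) = m * (1 + T * (H + 1)) := by
      rw [numEpisodes]
      push_cast
      ring
    rw [hN]
    -- `608256066 = 9216001 · 3 · 22`. Two of the factors `Λ` come from `m` and one from `T`.
    calc (m : ℝ) * (1 + T * (H + 1)) ≤ 9216001 * Q * (3 * (22 * (H * d * Λ) * H)) :=
          mul_le_mul hmQ (hTH3.trans (by gcongr)) (by positivity) (by positivity)
      _ = 608256066 * (a ^ 2 * d ^ 2 * D * H ^ 6 * l / (ε ^ 2 * σ ^ 2)) * Λ ^ 3 := by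
          rw [hQ]
          field_simp
          norm_num

end Parameters

end POMDPLearning

/-! ### Assembly of the theorem. -/

open POMDPLearning in
theorem mainTheorem5 :
    (∀ (S O A : Type*) [Fintype S] [DecidableEq S] [Fintype O] [Fintype A] [Nonempty A]
      (H M K : ℕ) (σ : ℝ) (P : POMDP S O A), 1 ≤ H → 1 ≤ K → 0 < σ →
      (∀ h < H, ∀ s o a, 0 ≤ P.reward h s o a ∧ P.reward h s o a ≤ 1) →
      (P.obsMatrix K).rank = Fintype.card S → oneNorm (pinv (P.obsMatrix K)) ≤ 1 / σ →
      P.linkClass H M K ⊆ boundedLinks O A H M K (H / σ) ∧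
      ∀ G : Set (Link O A M K), G = P.linkClass H M K ∨ G = boundedLinks O A H M K (H / σ) →
        P.IsPOBilinear H G
          (Fintype.card S * Fintype.card O ^ M * Fintype.card A ^ M) 1
          (4 * H * √(Fintype.card S * Fintype.card O ^ M * Fintype.card A ^ M : ℝ) / σ)) ∧
    ∃ (c : ℝ) (p : ℕ), 0 < c ∧
      ∀ (S O A : Type*) [Fintype S] [DecidableEq S] [Nonempty S] [Fintype O] [Nonempty O]
        [Fintype A] [Nonempty A] (H M K : ℕ) (σ ε δ : ℝ),
        1 ≤ H → 1 ≤ K → 0 < σ → σ ≤ 1 → 0 < ε → ε ≤ H → 0 < δ → δ < 1 →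
        ∃ (m T : ℕ) (R : ℝ), 0 < m ∧ 0 < T ∧
          (numEpisodes H m T : ℝ) ≤
            c * ((Fintype.card A : ℝ) ^ (3 * M + K + 2) * (Fintype.card O : ℝ) ^ (3 * M + K) *
                (Fintype.card S : ℝ) ^ 2 * (H : ℝ) ^ 6 * (1 + Real.log (1 / δ)) / (ε ^ 2 * σ ^ 2)) *
              (1 + Real.log ((Fintype.card S : ℝ) * (Fintype.card O : ℝ) ^ (M + K) *
                (Fintype.card A : ℝ) ^ (M + K) * (H : ℝ) ^ 2 * (1 + Real.log (1 / δ)) /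
                (ε * σ))) ^ p ∧
          ∀ P : POMDP S O A,
            (∀ h < H, ∀ s o a, 0 ≤ P.reward h s o a ∧ P.reward h s o a ≤ 1) →
            (P.obsMatrix K).rank = Fintype.card S →
            oneNorm (pinv (P.obsMatrix K)) ≤ 1 / σ →
            ∀ G : Set (Link O A M K),
              G = P.linkClass H M K ∨ G = boundedLinks O A H M K (H / σ) →
              ∀ L : Learner O A H M K m T G R,
                ENNReal.ofReal (1 - δ) ≤ (L.dataLaw P T).toOuterMeasure
                  {ω | ∀ π : Policy O A M, P.J H π - P.J H (L.output ω.1 ω.2) ≤ ε} := by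
  refine ⟨fun S O A _ _ _ _ _ H M K σ P hH _ hσ hr hP hpinv => ?_, 608256066, 3, by norm_num,
    fun S O A _ _ _ _ _ _ _ H M K σ ε δ hH hK hσ hσ1 hε hεH hδ hδ1 => ?_⟩
  · have hsub := P.linkClass_subset (M := M) H hpinv
    refine ⟨hsub, fun G hG => ?_⟩
    have hGB : G ⊆ boundedLinks O A H M K (H / σ) := by
      rcases hG with rfl | rfl
      · exact hsub
      · exact subset_rfl
    have h1 := P.one_le_inv_of_oneNorm_pinv_le hP hpinv
    have hB : 1 ≤ H / σ := by
      have hH1 : (1 : ℝ) ≤ H := by exact_mod_cast hH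
      rw [div_eq_mul_one_div]
      exact one_le_mul_of_one_le_of_one_le hH1 h1
    have h2 := P.isPOBilinear_of_subset hr hB hGB (P.exists_isValueLink hr hP hpinv hG) _ le_rfl
    convert h2 using 1
    push_cast
    ring
  · set s : ℝ := (Fintype.card S : ℝ) with hs
    set o : ℝ := (Fintype.card O : ℝ) with ho
    set a : ℝ := (Fintype.card A : ℝ) with ha
    have hs1 : 1 ≤ s := Nat.one_le_cast.2 (Fintype.card_pos (α := S))
    have ho1 : 1 ≤ o := Nat.one_le_cast.2 (Fintype.card_pos (α := O))
    have ha1 : 1 ≤ a := Nat.one_le_cast.2 (Fintype.card_pos (α := A))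
    have hH1 : (1 : ℝ) ≤ H := by exact_mod_cast hH
    have hl1 : 1 ≤ 1 + Real.log (1 / δ) := by
      have : 0 ≤ Real.log (1 / δ) := Real.log_nonneg ((one_le_div hδ).2 hδ1.le)
      linarith
    have hd1 : 1 ≤ s * o ^ M * a ^ M := one_le_mul_of_one_le_of_one_le
      (one_le_mul_of_one_le_of_one_le hs1 (one_le_pow₀ ho1)) (one_le_pow₀ ha1)
    have hV : ((2 ^ (3 * (Fintype.card O * Fintype.card A) ^ (M + K)) : ℕ) : ℝ) ≤
        Real.exp (3 * (o * a) ^ (M + K)) := by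
      have h2 : (2 : ℝ) ≤ Real.exp 1 := by linarith [Real.add_one_le_exp (1 : ℝ)]
      have h3 : (3 * (o * a) ^ (M + K) : ℝ) =
          (3 * (Fintype.card O * Fintype.card A) ^ (M + K) : ℕ) := by
        push_cast
        rfl
      rw [h3, ← Real.exp_one_pow, Nat.cast_pow]
      exact pow_le_pow_left₀ (by norm_num) (by exact_mod_cast h2) _
    have hq : s * o ^ M * a ^ M * (H : ℝ) ^ 2 / (ε * σ) ≤
        s * o ^ (M + K) * a ^ (M + K) * (H : ℝ) ^ 2 * (1 + Real.log (1 / δ)) / (ε * σ) := by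
      have h1 : o ^ M ≤ o ^ (M + K) := pow_le_pow_right₀ ho1 (Nat.le_add_right _ _)
      have h2 : a ^ M ≤ a ^ (M + K) := pow_le_pow_right₀ ha1 (Nat.le_add_right _ _)
      refine div_le_div_of_nonneg_right ?_ (by positivity)
      calc s * o ^ M * a ^ M * (H : ℝ) ^ 2 ≤ s * o ^ (M + K) * a ^ (M + K) * (H : ℝ) ^ 2 := by
            gcongr
        _ ≤ _ := le_mul_of_one_le_right (by positivity) hl1
    have hD1 : 1 ≤ (o * a) ^ (M + K) := one_le_pow₀ (one_le_mul_of_one_le_of_one_le ho1 ha1)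
    obtain ⟨T, η, hT, hTup, hη, hη2, hTd, hηε, hηε2⟩ :=
      exists_iterations hd1 hH1 hσ hσ1 hε hεH hq
    obtain ⟨m, hm, hprob, hN⟩ := exists_batch_size ha1 hd1 hD1 hH1 hσ hσ1 hε hεH hδ hδ1 hq
      (Nat.cast_nonneg _) hV hT hTup hη hη2
    replace hT : 2 ≤ T := by exact_mod_cast hT
    -- With `d = |S||O|^M|A|^M` and `D = (|O||A|)^(M+K)`, the product `|A|² d² D` has the stated
    -- exponents.
    refine ⟨m, T, η ^ 2, hm, by omega, hN.trans (le_of_eq ?_), ?_⟩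
    · congr 3
      ring
    intro P hr hP hpinv G hG L
    have hB : 1 ≤ H / σ := (one_le_div hσ).2 (hσ1.trans hH1)
    have hHB : (H : ℝ) ≤ H / σ := le_div_self (by linarith) hσ hσ1
    have hGB : G ⊆ boundedLinks O A H M K (H / σ) := by
      rcases hG with rfl | rfl
      · exact P.linkClass_subset H hpinv
      · exact subset_rfl
    have hGc : IsCompact G := by
      rcases hG with rfl | rfl
      · exact P.isCompact_linkClass H
      · exact isCompact_boundedLinks H _
    have hv := P.exists_isValueLink hr hP hpinv hG
    refine le_toOuterMeasure_of_compl _ _ hδ.le (le_trans (MeasureTheory.measure_mono ?_)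
      ((L.prob_not_goodData_le P hr hB hHB hη hm ?_ ?_ ?_ T).trans
        (ENNReal.ofReal_le_ofReal hprob)))
    · intro ω hω hgood
      refine hω fun π => L.suboptimality_le P hr hB (d := s * o ^ M * a ^ M) (fun h => ?_)
        (by linarith) hη hGc hGB hv hT hTd hε.le hηε hηε2 ω hgood π
      exact (Nat.cast_le.2 (card_mem_prod_le S O A M h)).trans_eq (by push_cast; rfl)
    · exact_mod_cast Nat.one_le_two_pow
    · exact_mod_cast card_fut_bool_le O A M K
    · exact fun h => by exact_mod_cast card_tdVertex_le O A M h hK
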